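/- Let $p$ be a prime, $k$ a field of characteristic $p$, $G$ a compact $p$-adic analytic group, and $H$ an open (not necessarily normal) subgroup of $G$. Let $kG=\varprojlim_N k[G/N]$ (over the open normal subgroups $N$ of $G$) denote the completed group ring, and similarly $kH$, regarded as a subring of $kG$. For an ideal $L$ of $kH$, let $L^G$ denote the induced ideal, i.e. the largest two-sided ideal of $kG$ contained in the right ideal $LkG$. For a prime ideal $P$ of a ring $R$, let $h(P)\in\mathbb{N}\cup\{\infty\}$ denote its height, i.e. the supremum of the integers $r$ for which there is a chain $P_0\subsetneq P_1\subsetneq\dots\subsetneq P_r=P$ of prime ideals of $R$. Let $Q$ be a prime ideal of $kH$, and let $P$ be a prime ideal of $kG$ containing $Q^G$. If $P$ is minimal among the prime ideals of $kG$ containing $Q^G$, then $h(P)=h(Q)$. -/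

import Mathlib

open scoped Manifold ContDiff

/-- A topological group is `p`-adic analytic if it carries the structure of a finite-dimensional
analytic manifold over `ℚ_[p]` for which multiplication and inversion are analytic maps
(the smoothness exponent `ω` means analytic). -/
def IsPAdicAnalyticGroup (p : ℕ) [Fact p.Prime] (G : Type*) [Group G] [TopologicalSpace G] :
    Prop :=
  ∃ (d : ℕ) (_ : ChartedSpace (Fin d → ℚ_[p]) G), LieGroup 𝓘(ℚ_[p], Fin d → ℚ_[p]) ω G

section CompletedGroupAlgebra

variable (k : Type*) [Field k] (G : Type*) [Group G] [TopologicalSpace G]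

/-- The transition map `k[G/N] → k[G/M]` for open normal subgroups `N ≤ M`. -/
noncomputable def groupAlgebraTransition {N M : OpenNormalSubgroup G} (h : N ≤ M) :
    MonoidAlgebra k (G ⧸ N.toSubgroup) →ₐ[k] MonoidAlgebra k (G ⧸ M.toSubgroup) :=
  MonoidAlgebra.mapDomainAlgHom k k
    (QuotientGroup.map N.toSubgroup M.toSubgroup (MonoidHom.id G) fun _ hx => h hx)

/-- The inverse limit of the group algebras `k[G/N]`, where `N` runs over the open normal
subgroups of `G`, as a subalgebra of the product: the compatible families. -/
noncomputable def completedGroupSubalgebra :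
    Subalgebra k (∀ N : OpenNormalSubgroup G, MonoidAlgebra k (G ⧸ N.toSubgroup)) where
  carrier := {x | ∀ (N M : OpenNormalSubgroup G) (h : N ≤ M),
    groupAlgebraTransition k G h (x N) = x M}
  mul_mem' := fun hx hy N M h => by
    rw [Pi.mul_apply, Pi.mul_apply, map_mul, hx N M h, hy N M h]
  add_mem' := fun hx hy N M h => by
    rw [Pi.add_apply, Pi.add_apply, map_add, hx N M h, hy N M h]
  algebraMap_mem' := fun r N M h => by
    rw [Pi.algebraMap_apply, Pi.algebraMap_apply, AlgHom.commutes]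

/-- The completed group ring `kG` of the topological group `G` over `k`. -/
abbrev CompletedGroupAlgebra : Type _ := completedGroupSubalgebra k G

variable {G}

/-- The intersection `N ∩ H`, as an open normal subgroup of the open subgroup `H`. -/
def OpenNormalSubgroup.restrict (N : OpenNormalSubgroup G) (H : OpenSubgroup G) :
    OpenNormalSubgroup H where
  toOpenSubgroup :=
    N.toOpenSubgroup.comap H.toSubgroup.subtype continuous_subtype_val
  isNormal' := Subgroup.Normal.comap N.isNormal' H.toSubgroup.subtype

/-- The map `k[H/(N ∩ H)] → k[G/N]` induced by the inclusion of `H` in `G`. -/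
noncomputable def groupAlgebraInclusion (H : OpenSubgroup G) (N : OpenNormalSubgroup G) :
    MonoidAlgebra k (H ⧸ (N.restrict H).toSubgroup) →ₐ[k] MonoidAlgebra k (G ⧸ N.toSubgroup) :=
  MonoidAlgebra.mapDomainAlgHom k k
    (QuotientGroup.map (N.restrict H).toSubgroup N.toSubgroup H.toSubgroup.subtype fun _ hx => hx)

theorem groupAlgebraTransition_comp_inclusion (H : OpenSubgroup G) {N M : OpenNormalSubgroup G}
    (h : N ≤ M) (h' : N.restrict H ≤ M.restrict H) :
    (groupAlgebraTransition k G h).comp (groupAlgebraInclusion k H N) =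
      (groupAlgebraInclusion k H M).comp (groupAlgebraTransition k H h') := by
  unfold groupAlgebraTransition groupAlgebraInclusion
  rw [← MonoidAlgebra.mapDomainAlgHom_comp, ← MonoidAlgebra.mapDomainAlgHom_comp]
  congr 1
  ext x
  rfl

/-- The natural map `kH → kG` for an open subgroup `H` of `G`. -/
noncomputable def completedInclusion (H : OpenSubgroup G) :
    CompletedGroupAlgebra k H →ₐ[k] CompletedGroupAlgebra k G :=
  AlgHom.codRestrict
    (AlgHom.pi fun N => (groupAlgebraInclusion k H N).comp
      ((Pi.evalAlgHom k _ (N.restrict H)).comp (completedGroupSubalgebra k H).val))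
    (completedGroupSubalgebra k G)
    (fun x N M h => by
      have h' : N.restrict H ≤ M.restrict H := fun y hy => h hy
      have e := x.2 (N.restrict H) (M.restrict H) h'
      have c := DFunLike.congr_fun (groupAlgebraTransition_comp_inclusion k H h h')
        (x.1 (N.restrict H))
      simp only [AlgHom.comp_apply] at c
      rw [e] at c
      exact c)

variable {k}

/-- The right ideal `L kG` of `kG` generated by an ideal `L` of `kH`. Right ideals are
submodules for the right multiplication action, that is, for the opposite ring. -/
noncomputable def extendedRightIdeal {H : OpenSubgroup G}
    (L : TwoSidedIdeal (CompletedGroupAlgebra k H)) :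
    Submodule (CompletedGroupAlgebra k G)ᵐᵒᵖ (CompletedGroupAlgebra k G) :=
  Submodule.span _ {x | ∃ y ∈ L, completedInclusion k H y = x}

/-- The induced ideal `L^G`: the largest two-sided ideal of `kG` contained in the right ideal
`L kG` (see `isGreatest_inducedIdeal`), given as the annihilator of the right module
`kG / L kG`. -/
noncomputable def inducedIdeal {H : OpenSubgroup G}
    (L : TwoSidedIdeal (CompletedGroupAlgebra k H)) :
    TwoSidedIdeal (CompletedGroupAlgebra k G) :=
  TwoSidedIdeal.mk' {x | ∀ a, a * x ∈ extendedRightIdeal L}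
    (fun a => by rw [mul_zero]; exact zero_mem _)
    (fun hx hy a => by rw [mul_add]; exact add_mem (hx a) (hy a))
    (fun {x} hx a => by
      have h : a * -x = -(a * x) := mul_neg a x
      exact h.symm ▸ neg_mem (hx a))
    (fun {x y} hy a => by rw [← mul_assoc]; exact hy (a * x))
    (fun {x y} hx a => by
      rw [← mul_assoc]
      exact (extendedRightIdeal L).smul_mem (MulOpposite.op y) (hx a))

theorem mem_inducedIdeal {H : OpenSubgroup G} (L : TwoSidedIdeal (CompletedGroupAlgebra k H))
    (x : CompletedGroupAlgebra k G) :
    x ∈ inducedIdeal L ↔ ∀ a, a * x ∈ extendedRightIdeal L := by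
  unfold inducedIdeal
  rw [TwoSidedIdeal.mem_mk']
  rfl

theorem isGreatest_inducedIdeal {H : OpenSubgroup G}
    (L : TwoSidedIdeal (CompletedGroupAlgebra k H)) :
    IsGreatest {J : TwoSidedIdeal (CompletedGroupAlgebra k G) |
      ∀ x ∈ J, x ∈ extendedRightIdeal L} (inducedIdeal L) := by
  refine ⟨fun x hx => ?_, fun J hJ x hx => ?_⟩
  · have := (mem_inducedIdeal L x).1 hx 1
    rwa [one_mul] at this
  · exact (mem_inducedIdeal L x).2 fun a => hJ _ (J.mul_mem_left a x hx)

end CompletedGroupAlgebra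

section Primes

/-- A prime ideal of a (not necessarily commutative) ring: a proper two-sided ideal `P` such that
`A B ⊆ P` implies `A ⊆ P` or `B ⊆ P` for all two-sided ideals `A`, `B`. -/
def IsPrimeTwoSided {R : Type*} [Ring R] (P : TwoSidedIdeal R) : Prop :=
  P ≠ ⊤ ∧ ∀ A B : TwoSidedIdeal R, (∀ a ∈ A, ∀ b ∈ B, a * b ∈ P) → A ≤ P ∨ B ≤ P

/-- The set of prime ideals of `R`, partially ordered by inclusion. -/
abbrev PrimeTwoSidedIdeal (R : Type*) [Ring R] : Type _ := {P : TwoSidedIdeal R // IsPrimeTwoSided P}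

/-- The height of a prime ideal `P`: the supremum in `ℕ ∪ {∞}` of the lengths `r` of the chains
`P₀ < P₁ < ⋯ < P_r = P` of prime ideals. -/
noncomputable def primeHeight {R : Type*} [Ring R] (P : PrimeTwoSidedIdeal R) : ℕ∞ :=
  ⨆ (c : LTSeries (PrimeTwoSidedIdeal R)) (_ : c.last = P), (c.length : ℕ∞)

end Primes

/-!
The result holds for every compact group `G`; it follows from a comparison of primes in crossed
products of finite groups over arbitrary rings, and no chain condition on the rings is needed.

Let `N` be the normal core of `H`, put `R = kN`, `S = kH`, `T = kG`. Both `S` and `T` are crossed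
products over `R`: they are free over `R` on finitely many group elements, which normalize `R`
(`isCrossed_subalgebraImage`). A prime `P` of such a crossed product contracts to the intersection
`core 𝔮` of the finitely many conjugates of a prime `𝔮` of `R` (`exists_isPrime_core_eq`). It is
enough to show that `P` and `𝔮` then have the same height (`height_eq`), and that a prime of `T`
minimal over the ideal induced from `Q` lies over the same `𝔮` as `Q`
(`height_eq_of_minimal_induced`).

Fix `𝔮`. Call an invariant ideal `I` of `R` dense if it is not contained in `𝔮`, and regard two
`(R, R)`-bimodules `X ⊆ Y` as equal up to denominators if `I Y ⊆ X` for some dense `I`. Each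
bimodule between `core 𝔮 * S` and `S` has ideals of leading coefficients with respect to the free basis, and
up to denominators it is determined by the set of conjugates of `𝔮` that do not contain these ideals
(`exists_isDense_mul_le`). Hence, up to denominators, all these bimodules form a lattice of finite
length, and `S` modulo `core 𝔮 * S` behaves like a finite-dimensional algebra. Two consequences are
needed.

* If an ideal is saturated, that is, if dense ideals can be cancelled modulo it, then every prime
  containing it contains a saturated prime containing it (`exists_isSaturated_isPrime`). This is
  applied to `core 𝔮 * S`, which gives going down, and to the induced ideal, which is saturated
  because `T` is free over `S`.
* An ideal strictly containing a prime over `core 𝔮` contains a dense ideal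
  (`exists_isDense_le_of_lt`); this is incomparability. It corresponds to the fact that a prime
  finite-dimensional algebra is simple: there is a minimal left ideal `L`, the annihilator of a
  suitable bimodule inside `L` is a maximal left ideal, and finitely many translates of it by group
  elements intersect in zero, so that the algebra is semisimple.
-/

namespace CrossedExt

open Submodule

/-! ### Ideals, primes and conjugation inside a ring -/

section Relative

variable {T : Type*} [Ring T]

/-- `X` is a two-sided ideal of the subring `S` of `T`. Subrings, ideals and bimodules inside `T`
are all represented by additive subgroups of `T`, that is, by elements of the idempotent semiring
`Submodule ℤ T`, so that products of ideals are products in that semiring. -/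
structure IsIdealIn (S X : Submodule ℤ T) : Prop where
  le : X ≤ S
  mul_left : S * X ≤ X
  mul_right : X * S ≤ X

/-- `P` is a prime ideal of the subring `S` of `T`. -/
structure IsPrimeIn (S P : Submodule ℤ T) : Prop where
  isIdeal : IsIdealIn S P
  not_le : ¬ S ≤ P
  le_or_le_of_ideals : ∀ B C, IsIdealIn S B → IsIdealIn S C → B * C ≤ P → B ≤ P ∨ C ≤ P

/-- The additive subgroup `S` is a subring of `T`. -/
structure IsSubringIn (S : Submodule ℤ T) : Prop where
  one_le : 1 ≤ S
  mul_le : S * S ≤ S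

theorem IsSubringIn.self_isIdeal {S : Submodule ℤ T} (hS : IsSubringIn S) : IsIdealIn S S :=
  ⟨le_rfl, hS.mul_le, hS.mul_le⟩

theorem IsSubringIn.le_mul {S : Submodule ℤ T} (hS : IsSubringIn S) (X : Submodule ℤ T) :
    X ≤ S * X := by
  calc X = 1 * X := (one_mul X).symm
    _ ≤ S * X := mul_le_mul' hS.one_le le_rfl

theorem IsSubringIn.le_mul' {S : Submodule ℤ T} (hS : IsSubringIn S) (X : Submodule ℤ T) :
    X ≤ X * S := by
  calc X = X * 1 := (mul_one X).symm
    _ ≤ X * S := mul_le_mul' le_rfl hS.one_le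

theorem IsIdealIn.left_eq {S X : Submodule ℤ T} (hX : IsIdealIn S X) (hS : IsSubringIn S) :
    S * X = X := le_antisymm hX.mul_left (hS.le_mul X)

theorem IsIdealIn.right_eq {S X : Submodule ℤ T} (hX : IsIdealIn S X) (hS : IsSubringIn S) :
    X * S = X := le_antisymm hX.mul_right (hS.le_mul' X)

theorem IsIdealIn.mul {S X Y : Submodule ℤ T} (hX : IsIdealIn S X) (hY : IsIdealIn S Y) :
    IsIdealIn S (X * Y) where
  le := (mul_le_mul' hX.le le_rfl).trans (hY.mul_left.trans hY.le)
  mul_left := by rw [← mul_assoc]; exact mul_le_mul' hX.mul_left le_rfl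
  mul_right := by rw [mul_assoc]; exact mul_le_mul' le_rfl hY.mul_right

theorem IsIdealIn.sup {S X Y : Submodule ℤ T} (hX : IsIdealIn S X) (hY : IsIdealIn S Y) :
    IsIdealIn S (X ⊔ Y) where
  le := sup_le hX.le hY.le
  mul_left := by rw [Submodule.mul_sup]; exact sup_le_sup hX.mul_left hY.mul_left
  mul_right := by rw [Submodule.sup_mul]; exact sup_le_sup hX.mul_right hY.mul_right

theorem IsIdealIn.mul_le_left {S X Y : Submodule ℤ T} (hX : IsIdealIn S X) (hY : Y ≤ S) :
    X * Y ≤ X := (mul_le_mul' le_rfl hY).trans hX.mul_right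

theorem IsIdealIn.mul_le_right {S X Y : Submodule ℤ T} (hX : IsIdealIn S X) (hY : Y ≤ S) :
    Y * X ≤ X := (mul_le_mul' hY le_rfl).trans hX.mul_left

theorem IsIdealIn.span {S X : Submodule ℤ T} (hS : IsSubringIn S) (hX : X ≤ S) :
    IsIdealIn S (S * X * S) where
  le := (mul_le_mul' ((mul_le_mul' le_rfl hX).trans hS.mul_le) le_rfl).trans hS.mul_le
  mul_left := by
    rw [← mul_assoc, ← mul_assoc]; exact mul_le_mul' (mul_le_mul' hS.mul_le le_rfl) le_rfl
  mul_right := by rw [mul_assoc]; exact mul_le_mul' le_rfl hS.mul_le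

theorem IsPrimeIn.le_or_le {S P X Y : Submodule ℤ T} (hP : IsPrimeIn S P) (hS : IsSubringIn S)
    (hX : X ≤ S) (hY : Y ≤ S) (h : X * S * Y ≤ P) : X ≤ P ∨ Y ≤ P := by
  have key : S * X * S * (S * Y * S) ≤ P := calc
    S * X * S * (S * Y * S) = S * (X * (S * S) * Y) * S := by simp only [mul_assoc]
    _ ≤ S * (X * S * Y) * S :=
      mul_le_mul' (mul_le_mul' le_rfl (mul_le_mul' (mul_le_mul' le_rfl hS.mul_le) le_rfl)) le_rfl
    _ ≤ S * P * S := mul_le_mul' (mul_le_mul' le_rfl h) le_rfl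
    _ ≤ P * S := mul_le_mul' hP.isIdeal.mul_left le_rfl
    _ ≤ P := hP.isIdeal.mul_right
  have hle (Z : Submodule ℤ T) : Z ≤ S * Z * S := (hS.le_mul Z).trans (hS.le_mul' _)
  exact (hP.le_or_le_of_ideals _ _ (.span hS hX) (.span hS hY) key).imp
    (hle X).trans (hle Y).trans

/-- Finitely many ideals not contained in a prime have a common lower bound that is an ideal not
contained in it. -/
theorem IsPrimeIn.exists_ideal_le {ι : Type*} {S P : Submodule ℤ T} (hP : IsPrimeIn S P)
    (hS : IsSubringIn S) (f : ι → Submodule ℤ T) (s : Finset ι)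
    (hf : ∀ i ∈ s, IsIdealIn S (f i)) (h : ∀ i ∈ s, ¬ f i ≤ P) :
    ∃ Y, IsIdealIn S Y ∧ ¬ Y ≤ P ∧ ∀ i ∈ s, Y ≤ f i := by
  classical
  induction s using Finset.induction_on with
  | empty => exact ⟨S, hS.self_isIdeal, hP.not_le, by simp⟩
  | insert a s ha ih =>
    obtain ⟨Y, hY, hYP, hYs⟩ := ih (fun i hi => hf i (Finset.mem_insert_of_mem hi))
      (fun i hi => h i (Finset.mem_insert_of_mem hi))
    have hfa := hf a (Finset.mem_insert_self a s)
    refine ⟨Y * f a, hY.mul hfa, fun hle => ?_, fun i hi => ?_⟩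
    · exact (hP.le_or_le_of_ideals _ _ hY hfa hle).elim hYP (h a (Finset.mem_insert_self a s))
    · rcases Finset.mem_insert.1 hi with rfl | hi
      · exact hfa.mul_le_right hY.le
      · exact (hY.mul_le_left hfa.le).trans (hYs i hi)

/-- The elements `t` of `S` with `t X ⊆ K`. -/
def leftResidual (S X K : Submodule ℤ T) : Submodule ℤ T where
  carrier := {t | t ∈ S ∧ ∀ x ∈ X, t * x ∈ K}
  add_mem' ha hb := ⟨add_mem ha.1 hb.1, fun x hx => by
    rw [add_mul]; exact add_mem (ha.2 x hx) (hb.2 x hx)⟩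
  zero_mem' := ⟨zero_mem S, fun x _ => by rw [zero_mul]; exact zero_mem K⟩
  smul_mem' n t ht := ⟨S.smul_mem n ht.1, fun x hx => by
    rw [smul_mul_assoc]; exact K.smul_mem n (ht.2 x hx)⟩

/-- The elements `t` of `S` with `X t ⊆ K`. -/
def rightResidual (S X K : Submodule ℤ T) : Submodule ℤ T where
  carrier := {t | t ∈ S ∧ ∀ x ∈ X, x * t ∈ K}
  add_mem' ha hb := ⟨add_mem ha.1 hb.1, fun x hx => by
    rw [mul_add]; exact add_mem (ha.2 x hx) (hb.2 x hx)⟩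
  zero_mem' := ⟨zero_mem S, fun x _ => by rw [mul_zero]; exact zero_mem K⟩
  smul_mem' n t ht := ⟨S.smul_mem n ht.1, fun x hx => by
    rw [mul_smul_comm]; exact K.smul_mem n (ht.2 x hx)⟩

theorem le_leftResidual {S X K Y : Submodule ℤ T} :
    Y ≤ leftResidual S X K ↔ Y ≤ S ∧ Y * X ≤ K := by
  rw [Submodule.mul_le]
  exact ⟨fun h => ⟨fun y hy => (h hy).1, fun y hy => (h hy).2⟩,
    fun h y hy => ⟨h.1 hy, h.2 y hy⟩⟩

theorem le_rightResidual {S X K Y : Submodule ℤ T} :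
    Y ≤ rightResidual S X K ↔ Y ≤ S ∧ X * Y ≤ K := by
  rw [Submodule.mul_le]
  exact ⟨fun h => ⟨fun y hy => (h hy).1, fun x hx y hy => (h hy).2 x hx⟩,
    fun h y hy => ⟨h.1 hy, fun x hx => h.2 x hx y hy⟩⟩

theorem leftResidual_mul_le (S X K : Submodule ℤ T) : leftResidual S X K * X ≤ K :=
  (le_leftResidual.1 le_rfl).2

theorem mul_rightResidual_le (S X K : Submodule ℤ T) : X * rightResidual S X K ≤ K :=
  (le_rightResidual.1 le_rfl).2

theorem leftResidual_le (S X K : Submodule ℤ T) : leftResidual S X K ≤ S :=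
  (le_leftResidual.1 le_rfl).1

theorem rightResidual_le (S X K : Submodule ℤ T) : rightResidual S X K ≤ S :=
  (le_rightResidual.1 le_rfl).1

end Relative

section Conj

variable {T : Type*} [Ring T] {Γ : Type*} [Group Γ] (u : Γ →* Tˣ)

/-- The additive subgroup generated by the unit `u g`. -/
def unitSpan (g : Γ) : Submodule ℤ T := span ℤ {(u g : T)}

/-- The conjugate of `X` by the unit `u g`. -/
def conj (g : Γ) (X : Submodule ℤ T) : Submodule ℤ T := unitSpan u g * X * unitSpan u g⁻¹

/-- The intersection of the conjugates of `X` by the units `u g`. -/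
def core (X : Submodule ℤ T) : Submodule ℤ T := ⨅ g, conj u g X

theorem unitSpan_mul (g h : Γ) : unitSpan u (g * h) = unitSpan u g * unitSpan u h := by
  simp [unitSpan, Submodule.span_mul_span]

theorem unitSpan_one : unitSpan u 1 = 1 := by
  simp [unitSpan, Submodule.one_eq_span]

theorem unitSpan_mul_inv (g : Γ) : unitSpan u g * unitSpan u g⁻¹ = 1 := by
  rw [← unitSpan_mul, mul_inv_cancel, unitSpan_one]

theorem unitSpan_inv_mul (g : Γ) : unitSpan u g⁻¹ * unitSpan u g = 1 := by
  rw [← unitSpan_mul, inv_mul_cancel, unitSpan_one]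

theorem mem_unitSpan (g : Γ) : (u g : T) ∈ unitSpan u g := Submodule.mem_span_singleton_self _

theorem mul_unitSpan_le {X Y : Submodule ℤ T} {g : Γ} :
    X * unitSpan u g ≤ Y ↔ X ≤ Y * unitSpan u g⁻¹ := by
  constructor
  · intro h
    calc X = X * unitSpan u g * unitSpan u g⁻¹ := by rw [mul_assoc, unitSpan_mul_inv, mul_one]
      _ ≤ _ := mul_le_mul' h le_rfl
  · intro h
    calc X * unitSpan u g ≤ Y * unitSpan u g⁻¹ * unitSpan u g := mul_le_mul' h le_rfl
      _ = Y := by rw [mul_assoc, unitSpan_inv_mul, mul_one]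

theorem conj_mono (g : Γ) {X Y : Submodule ℤ T} (h : X ≤ Y) : conj u g X ≤ conj u g Y :=
  mul_le_mul' (mul_le_mul' le_rfl h) le_rfl

theorem conj_conj (g h : Γ) (X : Submodule ℤ T) : conj u g (conj u h X) = conj u (g * h) X := by
  simp only [conj, mul_inv_rev, unitSpan_mul, mul_assoc]

theorem conj_one (X : Submodule ℤ T) : conj u 1 X = X := by
  simp [conj, unitSpan_one]

theorem conj_mul (g : Γ) (X Y : Submodule ℤ T) :
    conj u g (X * Y) = conj u g X * conj u g Y := by
  calc conj u g (X * Y) = unitSpan u g * X * 1 * Y * unitSpan u g⁻¹ := by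
        simp only [conj, mul_one, mul_assoc]
    _ = unitSpan u g * X * (unitSpan u g⁻¹ * unitSpan u g) * Y * unitSpan u g⁻¹ := by
        rw [unitSpan_inv_mul]
    _ = _ := by simp only [conj, mul_assoc]

theorem conj_le_iff (g : Γ) {X Y : Submodule ℤ T} : conj u g X ≤ Y ↔ X ≤ conj u g⁻¹ Y := by
  constructor
  · intro h
    have := conj_mono u g⁻¹ h
    rwa [conj_conj, inv_mul_cancel, conj_one] at this
  · intro h
    have := conj_mono u g h
    rwa [conj_conj, mul_inv_cancel, conj_one] at this

theorem mem_conj {g : Γ} {X : Submodule ℤ T} {x : T} :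
    x ∈ conj u g X ↔ ↑(u g)⁻¹ * x * ↑(u g) ∈ X := by
  rw [conj, unitSpan, unitSpan, Submodule.mem_mul_span_singleton]
  constructor
  · rintro ⟨z, hz, rfl⟩
    obtain ⟨y, hy, rfl⟩ := Submodule.mem_span_singleton_mul.1 hz
    simpa [mul_assoc] using hy
  · intro h
    refine ⟨_, Submodule.mem_span_singleton_mul.2 ⟨_, h, rfl⟩, ?_⟩
    simp [mul_assoc]

theorem core_le (X : Submodule ℤ T) : core u X ≤ X := by
  have := iInf_le (fun g => conj u g X) 1
  rwa [conj_one] at this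

theorem core_mono {X Y : Submodule ℤ T} (h : X ≤ Y) : core u X ≤ core u Y :=
  iInf_mono fun g => conj_mono u g h

theorem conj_core_le (g : Γ) (X : Submodule ℤ T) : conj u g (core u X) ≤ core u X := by
  refine le_iInf fun h => ?_
  have : core u X ≤ conj u (g⁻¹ * h) X := iInf_le _ _
  rw [conj_le_iff, conj_conj]
  exact this

theorem le_core {X Y : Submodule ℤ T} (hY : ∀ g, conj u g Y ≤ Y) (h : Y ≤ X) : Y ≤ core u X := by
  refine le_iInf fun g => ?_
  have := (conj_le_iff u g⁻¹).1 (hY g⁻¹)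
  rw [inv_inv] at this
  exact this.trans (conj_mono u g h)

theorem core_conj (g : Γ) (X : Submodule ℤ T) : core u (conj u g X) = core u X := by
  apply le_antisymm
  · refine le_core u (fun h => conj_core_le u h _) ?_
    have : core u (conj u g X) ≤ conj u g⁻¹ (conj u g X) := iInf_le _ _
    rwa [conj_conj, inv_mul_cancel, conj_one] at this
  · exact le_core u (fun h => conj_core_le u h _) (iInf_le _ g)

/-- An additive subgroup stable under conjugation by the unit `u g` and its inverse commutes
with `u g`. -/
theorem unitSpan_mul_comm {X : Submodule ℤ T} (hX : ∀ g, conj u g X ≤ X) (g : Γ) :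
    unitSpan u g * X = X * unitSpan u g := by
  have h1 (g : Γ) : unitSpan u g * X ≤ X * unitSpan u g := by
    have := (mul_unitSpan_le u (g := g⁻¹)).1 (hX g)
    rwa [inv_inv] at this
  refine le_antisymm (h1 g) ?_
  have h2 := mul_le_mul' (le_refl (unitSpan u g)) (mul_le_mul' (h1 g⁻¹) (le_refl (unitSpan u g)))
  rwa [mul_assoc X, unitSpan_inv_mul, mul_one, ← mul_assoc, ← mul_assoc, unitSpan_mul_inv,
    one_mul] at h2

end Conj

/-! ### Crossed products and dense ideals -/

section Crossed

variable {T : Type*} [Ring T] {Γ : Type*} [Group Γ] (u : Γ →* Tˣ)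

/-- The subring `S` of `T` is a crossed product over its subring `R`: the units `u g` normalize
`R`, up to units of `R` they are the members of the finite family `u (s i)`, and `S` is the free
left `R`-module on that family. -/
structure IsCrossed (R S : Submodule ℤ T) {m : ℕ} (s : Fin m → Γ) : Prop where
  base_isSubring : IsSubringIn R
  conj_le : ∀ g, conj u g R ≤ R
  exists_rep : ∀ g, ∃ i, unitSpan u (g * (s i)⁻¹) ≤ R ∧ unitSpan u (s i * g⁻¹) ≤ R
  eq_iSup : S = ⨆ i, R * unitSpan u (s i)
  free : ∀ r : Fin m → T, (∀ i, r i ∈ R) → ∑ i, r i * (u (s i) : T) = 0 → ∀ i, r i = 0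

/-- A `Γ`-invariant ideal of `R` not contained in the prime `𝔮`. For the purpose of the
comparison of primes, such ideals play the role of denominators. -/
structure IsDense (R 𝔮 I : Submodule ℤ T) : Prop where
  isIdeal : IsIdealIn R I
  conj_le : ∀ g, conj u g I ≤ I
  not_le : ¬ I ≤ 𝔮

variable {u} {R S : Submodule ℤ T} {m : ℕ} {s : Fin m → Γ}

namespace IsCrossed

variable (h : IsCrossed u R S s)

include h

theorem comm (g : Γ) : unitSpan u g * R = R * unitSpan u g := unitSpan_mul_comm u h.conj_le g

theorem mul_unitSpan_le (g : Γ) : R * unitSpan u g ≤ S := by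
  obtain ⟨i, hi, -⟩ := h.exists_rep g
  calc R * unitSpan u g = R * (unitSpan u (g * (s i)⁻¹) * unitSpan u (s i)) := by
        rw [← unitSpan_mul, inv_mul_cancel_right]
    _ ≤ R * (R * unitSpan u (s i)) := mul_le_mul' le_rfl (mul_le_mul' hi le_rfl)
    _ ≤ R * unitSpan u (s i) := by
        rw [← mul_assoc]; exact mul_le_mul' h.base_isSubring.mul_le le_rfl
    _ ≤ S := by rw [h.eq_iSup]; exact le_iSup (fun i => R * unitSpan u (s i)) i

theorem le : R ≤ S := by
  have := h.mul_unitSpan_le 1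
  rwa [unitSpan_one, mul_one] at this

theorem unitSpan_le (g : Γ) : unitSpan u g ≤ S :=
  (h.base_isSubring.le_mul _).trans (h.mul_unitSpan_le g)

theorem isSubring : IsSubringIn S where
  one_le := h.base_isSubring.one_le.trans h.le
  mul_le := by
    conv_lhs => rw [h.eq_iSup]
    simp only [Submodule.iSup_mul, Submodule.mul_iSup]
    refine iSup_le fun j => iSup_le fun i => ?_
    calc R * unitSpan u (s i) * (R * unitSpan u (s j))
        = R * (unitSpan u (s i) * R) * unitSpan u (s j) := by simp only [mul_assoc]
      _ = R * R * unitSpan u (s i * s j) := by rw [h.comm, unitSpan_mul]; simp only [mul_assoc]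
      _ ≤ R * unitSpan u (s i * s j) := mul_le_mul' h.base_isSubring.mul_le le_rfl
      _ ≤ S := h.mul_unitSpan_le _

theorem conj_eq_self (g : Γ) : conj u g R = R :=
  le_antisymm (h.conj_le g) (by rw [← inv_inv g, ← conj_le_iff]; exact h.conj_le _)

theorem conj_isIdeal {X : Submodule ℤ T} (hX : IsIdealIn R X) (g : Γ) :
    IsIdealIn R (conj u g X) where
  le := (conj_mono u g hX.le).trans (h.conj_le g)
  mul_left := by
    conv_lhs => rw [← h.conj_eq_self g]
    rw [← conj_mul]; exact conj_mono u g hX.mul_left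
  mul_right := by
    conv_lhs => rw [← h.conj_eq_self g]
    rw [← conj_mul]; exact conj_mono u g hX.mul_right

theorem conj_le_conj {X : Submodule ℤ T} (hX : IsIdealIn R X) {a b : Γ}
    (h₁ : unitSpan u (a * b⁻¹) ≤ R) (h₂ : unitSpan u (b * a⁻¹) ≤ R) :
    conj u a X ≤ conj u b X := by
  have hb := h.conj_isIdeal hX b
  have e : conj u a X = conj u (a * b⁻¹) (conj u b X) := by rw [conj_conj, inv_mul_cancel_right]
  rw [e, conj, mul_inv_rev, inv_inv]
  exact (mul_le_mul' ((mul_le_mul' h₁ le_rfl).trans hb.mul_left) h₂).trans hb.mul_right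

theorem exists_conj_eq {X : Submodule ℤ T} (hX : IsIdealIn R X) (g : Γ) :
    ∃ i, conj u g X = conj u (s i) X := by
  obtain ⟨i, h₁, h₂⟩ := h.exists_rep g
  exact ⟨i, le_antisymm (h.conj_le_conj hX h₁ h₂) (h.conj_le_conj hX h₂ h₁)⟩

theorem conj_isPrime {𝔮 : Submodule ℤ T} (hq : IsPrimeIn R 𝔮) (g : Γ) :
    IsPrimeIn R (conj u g 𝔮) where
  isIdeal := h.conj_isIdeal hq.isIdeal g
  not_le hle := hq.not_le (by
    have := (conj_mono u g⁻¹ hle)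
    rwa [conj_conj, inv_mul_cancel, conj_one, h.conj_eq_self] at this)
  le_or_le_of_ideals B C hB hC hBC := by
    have key : conj u g⁻¹ B * conj u g⁻¹ C ≤ 𝔮 := by
      rw [← conj_mul, conj_le_iff, inv_inv]; exact hBC
    refine (hq.le_or_le_of_ideals _ _ (h.conj_isIdeal hB _) (h.conj_isIdeal hC _) key).imp ?_ ?_
    all_goals
      intro h'
      rwa [conj_le_iff, inv_inv] at h'

/-- The conjugates of an ideal of `R` are pairwise incomparable, as there are finitely many. -/
theorem conj_eq_of_le {X : Submodule ℤ T} (hX : IsIdealIn R X) {g k : Γ}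
    (hle : conj u g X ≤ conj u k X) : conj u g X = conj u k X := by
  obtain ⟨x, rfl⟩ : ∃ x, g = k * x := ⟨k⁻¹ * g, (mul_inv_cancel_left k g).symm⟩
  have hx : conj u x X ≤ X := by
    have := conj_mono u k⁻¹ hle
    rwa [conj_conj, conj_conj, inv_mul_cancel_left, inv_mul_cancel, conj_one] at this
  have anti : Antitone fun n : ℕ => conj u (x ^ n) X := by
    refine antitone_nat_of_succ_le fun n => ?_
    rw [pow_succ, ← conj_conj]; exact conj_mono u _ hx
  choose i hi using fun n : ℕ => h.exists_conj_eq hX (x ^ n)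
  obtain ⟨a, b, hab, he⟩ : ∃ a b : ℕ, a < b ∧ i a = i b := by
    obtain ⟨a, b, hne, he⟩ := Finite.exists_ne_map_eq_of_infinite i
    rcases lt_or_gt_of_ne hne with hlt | hlt
    · exact ⟨a, b, hlt, he⟩
    · exact ⟨b, a, hlt, he.symm⟩
  have h1 : conj u (x ^ a) X ≤ conj u (x ^ (a + 1)) X := by
    calc conj u (x ^ a) X = conj u (x ^ b) X := by rw [hi a, hi b, he]
      _ ≤ _ := anti hab
  have h2 : X ≤ conj u x X := by
    have := conj_mono u (x ^ a)⁻¹ h1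
    rwa [conj_conj, conj_conj, inv_mul_cancel, pow_succ, inv_mul_cancel_left, conj_one] at this
  rw [← conj_conj, le_antisymm hx h2]

theorem core_isIdeal {X : Submodule ℤ T} (hX : IsIdealIn R X) : IsIdealIn R (core u X) where
  le := (core_le u X).trans hX.le
  mul_left := le_iInf fun g => (mul_le_mul' le_rfl (iInf_le _ g)).trans
    (h.conj_isIdeal hX g).mul_left
  mul_right := le_iInf fun g => (mul_le_mul' (iInf_le _ g) le_rfl).trans
    (h.conj_isIdeal hX g).mul_right

theorem le_core_of_forall {X Y : Submodule ℤ T} (hX : IsIdealIn R X)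
    (hY : ∀ i, Y ≤ conj u (s i) X) : Y ≤ core u X := by
  refine le_iInf fun g => ?_
  obtain ⟨i, hi⟩ := h.exists_conj_eq hX g
  rw [hi]; exact hY i

theorem invariant_comm {I : Submodule ℤ T} (hI : IsIdealIn R I) (hc : ∀ g, conj u g I ≤ I) :
    I * S = S * I := by
  rw [h.eq_iSup, Submodule.iSup_mul, Submodule.mul_iSup]
  refine iSup_congr fun i => ?_
  rw [mul_assoc, unitSpan_mul_comm u hc, ← mul_assoc, ← mul_assoc, hI.right_eq h.base_isSubring,
    hI.left_eq h.base_isSubring]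

theorem invariant_mul_isIdeal {I : Submodule ℤ T} (hI : IsIdealIn R I)
    (hc : ∀ g, conj u g I ≤ I) : IsIdealIn S (I * S) where
  le := (mul_le_mul' (hI.le.trans h.le) le_rfl).trans h.isSubring.mul_le
  mul_left := by
    rw [← mul_assoc, ← h.invariant_comm hI hc, mul_assoc]
    exact mul_le_mul' le_rfl h.isSubring.mul_le
  mul_right := by rw [mul_assoc]; exact mul_le_mul' le_rfl h.isSubring.mul_le

theorem conj_ideal_le {P : Submodule ℤ T} (hP : IsIdealIn S P) (g : Γ) : conj u g P ≤ P :=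
  (mul_le_mul' (hP.mul_le_right (h.unitSpan_le g)) le_rfl).trans
    (hP.mul_le_left (h.unitSpan_le _))

theorem inf_isIdeal {P : Submodule ℤ T} (hP : IsIdealIn S P) : IsIdealIn R (P ⊓ R) where
  le := inf_le_right
  mul_left := le_inf ((mul_le_mul' h.le inf_le_left).trans hP.mul_left)
    ((mul_le_mul' le_rfl inf_le_right).trans h.base_isSubring.mul_le)
  mul_right := le_inf ((mul_le_mul' inf_le_left h.le).trans hP.mul_right)
    ((mul_le_mul' inf_le_right le_rfl).trans h.base_isSubring.mul_le)

theorem conj_inf_le {P : Submodule ℤ T} (hP : IsIdealIn S P) (g : Γ) :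
    conj u g (P ⊓ R) ≤ P ⊓ R :=
  le_inf ((conj_mono u g inf_le_left).trans (h.conj_ideal_le hP g))
    ((conj_mono u g inf_le_right).trans (h.conj_le g))

variable {𝔮 : Submodule ℤ T} (hq : IsPrimeIn R 𝔮)

omit h in
theorem _root_.CrossedExt.IsDense.not_le_conj {I : Submodule ℤ T} (hI : IsDense u R 𝔮 I) (g : Γ) :
    ¬ I ≤ conj u g 𝔮 := fun hle => hI.not_le (by
  have h1 := (conj_le_iff u g⁻¹ (X := I) (Y := 𝔮)).1
  have h2 := conj_mono u g⁻¹ hle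
  rw [conj_conj, inv_mul_cancel, conj_one] at h2
  have h3 := (conj_le_iff u g).1 (hI.conj_le g)
  exact h3.trans h2)

include hq

omit h in
theorem _root_.CrossedExt.IsDense.mul {I J : Submodule ℤ T} (hI : IsDense u R 𝔮 I)
    (hJ : IsDense u R 𝔮 J) : IsDense u R 𝔮 (I * J) where
  isIdeal := hI.isIdeal.mul hJ.isIdeal
  conj_le g := by rw [conj_mul]; exact mul_le_mul' (hI.conj_le g) (hJ.conj_le g)
  not_le hle := (hq.le_or_le_of_ideals _ _ hI.isIdeal hJ.isIdeal hle).elim hI.not_le hJ.not_le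

theorem isDense_self : IsDense u R 𝔮 R := ⟨h.base_isSubring.self_isIdeal, h.conj_le, hq.not_le⟩

/-- An ideal of `R` contained in no conjugate of the prime `𝔮` contains a dense ideal. -/
theorem exists_isDense_le {C : Submodule ℤ T} (hC : IsIdealIn R C)
    (hn : ∀ g, ¬ C ≤ conj u g 𝔮) : ∃ I, IsDense u R 𝔮 I ∧ I ≤ C := by
  refine ⟨core u C, ⟨h.core_isIdeal hC, fun g => conj_core_le u g C, fun hle => ?_⟩, core_le u C⟩
  obtain ⟨Y, -, hYq, hY⟩ := hq.exists_ideal_le h.base_isSubring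
      (fun i => conj u (s i) C) Finset.univ
    (fun i _ => h.conj_isIdeal hC _) (fun i _ hle => hn (s i)⁻¹ (by
      rwa [conj_le_iff] at hle))
  exact hYq ((h.le_core_of_forall hC fun i => hY i (Finset.mem_univ i)).trans hle)

/-- Comparison of two ideals of `R` modulo denominators: it suffices to test them on the
conjugates of `𝔮`. -/
theorem exists_isDense_mul_le_of_ideals {X Y : Submodule ℤ T} (hX : IsIdealIn R X)
    (hY : IsIdealIn R Y) (hA : core u 𝔮 ≤ X)
    (hXY : ∀ i, ¬ Y ≤ conj u (s i) 𝔮 → ¬ X ≤ conj u (s i) 𝔮) :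
    ∃ I, IsDense u R 𝔮 I ∧ I * Y ≤ X := by
  classical
  -- the intersection of the conjugates that do not contain `X`
  let D : Submodule ℤ T := R ⊓ ⨅ i, ⨅ (_ : ¬ X ≤ conj u (s i) 𝔮), conj u (s i) 𝔮
  have hDle (i) (hi : ¬ X ≤ conj u (s i) 𝔮) : D ≤ conj u (s i) 𝔮 :=
    inf_le_right.trans ((iInf_le _ i).trans (iInf_le _ hi))
  have hD : IsIdealIn R D := by
    refine ⟨inf_le_left, le_inf ?_ ?_, le_inf ?_ ?_⟩
    · exact (mul_le_mul' le_rfl inf_le_left).trans h.base_isSubring.mul_le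
    · exact le_iInf fun i => le_iInf fun hi => (mul_le_mul' le_rfl (hDle i hi)).trans
        (h.conj_isIdeal hq.isIdeal _).mul_left
    · exact (mul_le_mul' inf_le_left le_rfl).trans h.base_isSubring.mul_le
    · exact le_iInf fun i => le_iInf fun hi => (mul_le_mul' (hDle i hi) le_rfl).trans
        (h.conj_isIdeal hq.isIdeal _).mul_right
  have hDY : D * Y ≤ X := by
    refine le_trans (h.le_core_of_forall hq.isIdeal fun i => ?_) hA
    have hi := h.conj_isIdeal hq.isIdeal (s i)
    by_cases hX' : X ≤ conj u (s i) 𝔮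
    · exact (mul_le_mul' le_rfl (not_imp_not.1 (hXY i) hX')).trans (hi.mul_le_right hD.le)
    · exact (mul_le_mul' (hDle i hX') le_rfl).trans (hi.mul_le_left hY.le)
  obtain ⟨I, hI, hIC⟩ := h.exists_isDense_le hq (hX.sup hD) (fun g hle => by
    obtain ⟨j, hgj⟩ := h.exists_conj_eq hq.isIdeal g
    rw [hgj] at hle
    have hX' := le_sup_left.trans hle
    have hj := h.conj_isPrime hq (s j)
    obtain ⟨Z, hZ, hZj, hZD⟩ := hj.exists_ideal_le h.base_isSubring (fun i => conj u (s i) 𝔮)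
      (Finset.univ.filter fun i => ¬ X ≤ conj u (s i) 𝔮)
      (fun i _ => h.conj_isIdeal hq.isIdeal _) (fun i hi hle' => by
        have hi' := (Finset.mem_filter.1 hi).2
        rw [h.conj_eq_of_le hq.isIdeal hle'] at hi'
        exact hi' hX')
    refine hZj (le_trans (le_inf hZ.le ?_) (le_sup_right.trans hle))
    exact le_iInf fun i => le_iInf fun hi => hZD i (by simp [hi]))
  refine ⟨I, hI, (mul_le_mul' hIC le_rfl).trans ?_⟩
  rw [Submodule.sup_mul]
  exact sup_le (hX.mul_le_left hY.le) hDY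

end IsCrossed

end Crossed

/-! ### Leading coefficients, rank and contraction of primes -/

section Rank

variable {T : Type*} [Ring T] {Γ : Type*} [Group Γ] (u : Γ →* Tˣ)

/-- `X` is stable under multiplication by `R` on both sides. -/
structure IsBimod (R X : Submodule ℤ T) : Prop where
  mul_left : R * X ≤ X
  mul_right : X * R ≤ X

theorem IsBimod.sup {R X Y : Submodule ℤ T} (hX : IsBimod R X) (hY : IsBimod R Y) :
    IsBimod R (X ⊔ Y) where
  mul_left := by rw [Submodule.mul_sup]; exact sup_le_sup hX.mul_left hY.mul_left
  mul_right := by rw [Submodule.sup_mul]; exact sup_le_sup hX.mul_right hY.mul_right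

theorem IsBimod.inf {R X Y : Submodule ℤ T} (hX : IsBimod R X) (hY : IsBimod R Y) :
    IsBimod R (X ⊓ Y) where
  mul_left := le_inf ((mul_le_mul' le_rfl inf_le_left).trans hX.mul_left)
    ((mul_le_mul' le_rfl inf_le_right).trans hY.mul_left)
  mul_right := le_inf ((mul_le_mul' inf_le_left le_rfl).trans hX.mul_right)
    ((mul_le_mul' inf_le_right le_rfl).trans hY.mul_right)

theorem IsBimod.mul {R X Y : Submodule ℤ T} (hX : IsBimod R X) (hY : IsBimod R Y) :
    IsBimod R (X * Y) where
  mul_left := by rw [← mul_assoc]; exact mul_le_mul' hX.mul_left le_rfl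
  mul_right := by rw [mul_assoc]; exact mul_le_mul' le_rfl hY.mul_right

theorem IsIdealIn.isBimod {R S X : Submodule ℤ T} (hX : IsIdealIn S X) (hRS : R ≤ S) :
    IsBimod R X := ⟨hX.mul_le_right hRS, hX.mul_le_left hRS⟩

variable (R : Submodule ℤ T) {m : ℕ} (s : Fin m → Γ) (𝔮 : Submodule ℤ T)

/-- The `R`-span of the first `n` of the units `u (s i)`. -/
def partSpan (n : ℕ) : Submodule ℤ T := ⨆ i : Fin m, ⨆ _ : i.val < n, R * unitSpan u (s i)

/-- The ideal of leading coefficients, at the unit `u (s j)`, of the elements of `X` that lie in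
the `R`-span of the units up to `u (s j)`. -/
def leadIdeal (j : Fin m) (X : Submodule ℤ T) : Submodule ℤ T :=
  R ⊓ (X ⊔ partSpan u R s j.val) * unitSpan u (s j)⁻¹

open Classical in
/-- The pairs of a unit and a conjugate of `𝔮` such that the corresponding ideal of leading
coefficients of `X` is not contained in that conjugate. -/
noncomputable def leadSupport (X : Submodule ℤ T) : Finset (Fin m × Fin m) :=
  Finset.univ.filter fun a => ¬ leadIdeal u R s a.1 X ≤ conj u (s a.2) 𝔮

variable {u R s 𝔮}

theorem leadIdeal_mono (j : Fin m) {X Y : Submodule ℤ T} (hXY : X ≤ Y) :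
    leadIdeal u R s j X ≤ leadIdeal u R s j Y :=
  inf_le_inf le_rfl (mul_le_mul' (sup_le_sup hXY le_rfl) le_rfl)

theorem leadSupport_mono {X Y : Submodule ℤ T} (hXY : X ≤ Y) :
    leadSupport u R s 𝔮 X ⊆ leadSupport u R s 𝔮 Y := by
  intro a ha
  simp only [leadSupport, Finset.mem_filter, Finset.mem_univ, true_and] at ha ⊢
  exact fun h => ha ((leadIdeal_mono a.1 hXY).trans h)

theorem mem_leadIdeal {j : Fin m} {X : Submodule ℤ T} {r : T} :
    r ∈ leadIdeal u R s j X ↔ r ∈ R ∧ r * (u (s j) : T) ∈ X ⊔ partSpan u R s j.val := by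
  rw [leadIdeal, Submodule.mem_inf]
  refine and_congr Iff.rfl ?_
  rw [unitSpan, Submodule.mem_mul_span_singleton]
  constructor
  · rintro ⟨z, hz, rfl⟩
    simpa [mul_assoc] using hz
  · intro hr
    exact ⟨_, hr, by simp [mul_assoc]⟩

theorem partSpan_zero : partSpan u R s 0 = ⊥ := by simp [partSpan]

theorem partSpan_succ (j : Fin m) :
    partSpan u R s (j.val + 1) = R * unitSpan u (s j) ⊔ partSpan u R s j.val := by
  apply le_antisymm
  · refine iSup_le fun i => iSup_le fun hi => ?_
    rcases Nat.lt_succ_iff_lt_or_eq.1 hi with hlt | heq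
    · exact le_trans (le_iSup₂ (f := fun (i : Fin m) (_ : i.val < j.val) =>
        R * unitSpan u (s i)) i hlt) le_sup_right
    · rw [Fin.ext heq]; exact le_sup_left
  · refine sup_le ?_ ?_
    · exact le_iSup₂ (f := fun (i : Fin m) (_ : i.val < j.val + 1) =>
        R * unitSpan u (s i)) j (Nat.lt_succ_self _)
    · refine iSup_le fun i => iSup_le fun hi => ?_
      exact le_iSup₂ (f := fun (i : Fin m) (_ : i.val < j.val + 1) =>
        R * unitSpan u (s i)) i (Nat.lt_succ_of_lt hi)

variable {S : Submodule ℤ T}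

namespace IsCrossed

variable (h : IsCrossed u R S s)

include h

theorem partSpan_eq : partSpan u R s m = S := by
  rw [h.eq_iSup]; simp [partSpan]

theorem partSpan_isBimod (n : ℕ) : IsBimod R (partSpan u R s n) := by
  constructor
  · simp only [partSpan, Submodule.mul_iSup]
    refine iSup_mono fun i => iSup_mono fun _ => ?_
    rw [← mul_assoc]; exact mul_le_mul' h.base_isSubring.mul_le le_rfl
  · simp only [partSpan, Submodule.iSup_mul]
    refine iSup_mono fun i => iSup_mono fun _ => ?_
    rw [mul_assoc, h.comm, ← mul_assoc]; exact mul_le_mul' h.base_isSubring.mul_le le_rfl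

/-- Right multiplication by an invariant ideal of `R` acts on leading coefficients. -/
theorem leadIdeal_mul_le {I X : Submodule ℤ T} (hI : I ≤ R) (hc : ∀ g, conj u g I ≤ I)
    (j : Fin m) : leadIdeal u R s j X * I ≤ leadIdeal u R s j (X * I) := by
  refine le_inf ((mul_le_mul' inf_le_left hI).trans h.base_isSubring.mul_le) ?_
  refine (mul_le_mul' inf_le_right le_rfl).trans ?_
  rw [mul_assoc, unitSpan_mul_comm u hc, ← mul_assoc, Submodule.sup_mul]
  exact mul_le_mul' (sup_le_sup le_rfl
    ((mul_le_mul' le_rfl hI).trans (h.partSpan_isBimod _).mul_right)) le_rfl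

theorem mul_leadIdeal_le {I X : Submodule ℤ T} (hI : I ≤ R) (j : Fin m) :
    I * leadIdeal u R s j X ≤ leadIdeal u R s j (I * X) := by
  refine le_inf ((mul_le_mul' hI inf_le_left).trans h.base_isSubring.mul_le) ?_
  refine (mul_le_mul' le_rfl inf_le_right).trans ?_
  rw [← mul_assoc, Submodule.mul_sup]
  exact mul_le_mul' (sup_le_sup le_rfl
    ((mul_le_mul' hI le_rfl).trans (h.partSpan_isBimod _).mul_left)) le_rfl

theorem leadIdeal_isIdeal {X : Submodule ℤ T} (hX : IsBimod R X) (j : Fin m) :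
    IsIdealIn R (leadIdeal u R s j X) where
  le := inf_le_left
  mul_left := (h.mul_leadIdeal_le le_rfl j).trans (leadIdeal_mono j hX.mul_left)
  mul_right := (h.leadIdeal_mul_le le_rfl h.conj_le j).trans (leadIdeal_mono j hX.mul_right)

theorem le_leadIdeal {A X : Submodule ℤ T} (hA : A ≤ R) (hAX : A * S ≤ X) (j : Fin m) :
    A ≤ leadIdeal u R s j X := by
  refine le_inf hA ?_
  rw [← _root_.CrossedExt.mul_unitSpan_le]
  exact (mul_le_mul' le_rfl (h.unitSpan_le _)).trans (hAX.trans le_sup_left)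

/-- If multiplication by `I` sends leading coefficients of `Y` to leading coefficients of `X`,
then `I` lowers the leading term of the elements of `Y`, modulo `X`. -/
theorem exists_add_of_leadIdeal {I X Y : Submodule ℤ T} {j : Fin m} (hXY : X ≤ Y)
    (hI : I ≤ R) (hIle : I * leadIdeal u R s j Y ≤ leadIdeal u R s j X) {a y : T} (ha : a ∈ I)
    (hy : y ∈ Y) (hyV : y ∈ X ⊔ partSpan u R s (j.val + 1)) (hX : IsBimod R X) :
    a * y ∈ X ⊔ partSpan u R s j.val := by
  rw [partSpan_succ, sup_comm (R * _), ← sup_assoc] at hyV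
  obtain ⟨w, hw, z, hz, rfl⟩ := Submodule.mem_sup.1 hyV
  obtain ⟨r, hr, rfl⟩ := Submodule.mem_mul_span_singleton.1 hz
  have hrY : r ∈ leadIdeal u R s j Y := by
    refine mem_leadIdeal.2 ⟨hr, ?_⟩
    have hwY : w ∈ Y ⊔ partSpan u R s j.val := (sup_le_sup hXY le_rfl) hw
    have := sub_mem ((le_sup_left : Y ≤ Y ⊔ partSpan u R s j.val) hy) hwY
    rwa [add_sub_cancel_left] at this
  have h1 := (mem_leadIdeal.1 (hIle (Submodule.mul_mem_mul ha hrY))).2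
  rw [mul_add, ← mul_assoc]
  exact add_mem ((hX.sup (h.partSpan_isBimod _)).mul_left (Submodule.mul_mem_mul (hI ha) hw)) h1

variable (hq : IsPrimeIn R 𝔮)

include hq

/-- Up to denominators, a bimodule between `core 𝔮 * S` and `S` is determined within a larger one
by the finite set `leadSupport`. This is the finiteness underlying all comparisons of primes. -/
theorem exists_isDense_mul_le {X Y : Submodule ℤ T} (hX : IsBimod R X) (hY : IsBimod R Y)
    (hXY : X ≤ Y) (hYS : Y ≤ S) (hA : core u 𝔮 * S ≤ X)
    (hE : leadSupport u R s 𝔮 Y ⊆ leadSupport u R s 𝔮 X) :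
    ∃ I, IsDense u R 𝔮 I ∧ I * Y ≤ X := by
  have hlead (j : Fin m) : ∃ I, IsDense u R 𝔮 I ∧
      I * leadIdeal u R s j Y ≤ leadIdeal u R s j X := by
    refine h.exists_isDense_mul_le_of_ideals hq (h.leadIdeal_isIdeal hX j)
      (h.leadIdeal_isIdeal hY j) (h.le_leadIdeal ((core_le u 𝔮).trans hq.isIdeal.le) hA j) ?_
    intro i hi
    have := @hE (j, i) (by simpa [leadSupport] using hi)
    simpa [leadSupport] using this
  have key (n : ℕ) (hn : n ≤ m) :
      ∃ I, IsDense u R 𝔮 I ∧ I * (Y ⊓ (X ⊔ partSpan u R s n)) ≤ X := by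
    induction n with
    | zero =>
      refine ⟨R, h.isDense_self hq, ?_⟩
      rw [partSpan_zero, sup_bot_eq]
      exact (mul_le_mul' le_rfl inf_le_right).trans hX.mul_left
    | succ n ih =>
      obtain ⟨I, hI, hIX⟩ := ih (Nat.le_of_succ_le hn)
      obtain ⟨J, hJ, hJle⟩ := hlead ⟨n, hn⟩
      refine ⟨I * J, hI.mul hq hJ, ?_⟩
      rw [mul_assoc]
      refine (mul_le_mul' le_rfl (Submodule.mul_le.2 fun a ha y hy => ?_)).trans hIX
      exact ⟨hY.mul_left (Submodule.mul_mem_mul (hJ.isIdeal.le ha) hy.1),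
        h.exists_add_of_leadIdeal hXY hJ.isIdeal.le hJle ha hy.1 hy.2 hX⟩
  obtain ⟨I, hI, hIX⟩ := key m le_rfl
  refine ⟨I, hI, le_trans (mul_le_mul' le_rfl (le_inf le_rfl ?_)) hIX⟩
  rw [h.partSpan_eq]; exact hYS.trans le_sup_right

/-- Denominators can be moved from the left to the right of a bimodule. -/
theorem exists_isDense_mul_le_mul {I Y : Submodule ℤ T} (hI : IsDense u R 𝔮 I)
    (hY : IsBimod R Y) (hYS : Y ≤ S) (hA : core u 𝔮 * S ≤ Y) (hAS : IsBimod R (core u 𝔮 * S)) :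
    ∃ J, IsDense u R 𝔮 J ∧ J * Y ≤ Y * I ⊔ core u 𝔮 * S := by
  refine h.exists_isDense_mul_le hq ((hY.mul (hI.isIdeal.isBimod le_rfl)).sup hAS) hY ?_ hYS
    le_sup_right ?_
  · exact sup_le ((mul_le_mul' le_rfl hI.isIdeal.le).trans hY.mul_right) hA
  · intro a ha
    simp only [leadSupport, Finset.mem_filter, Finset.mem_univ, true_and] at ha ⊢
    intro hle
    have hp := h.conj_isPrime hq (s a.2)
    refine (hp.le_or_le_of_ideals _ _ (h.leadIdeal_isIdeal hY a.1) hI.isIdeal ?_).elim ha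
      (hI.not_le_conj _)
    exact (h.leadIdeal_mul_le hI.isIdeal.le hI.conj_le a.1).trans
      ((leadIdeal_mono a.1 le_sup_left).trans hle)

end IsCrossed

end Rank

section CuttingDown

variable {T : Type*} [Ring T] {Γ : Type*} [Group Γ] {u : Γ →* Tˣ}
variable {R S : Submodule ℤ T} {m : ℕ} {s : Fin m → Γ} (h : IsCrossed u R S s)

namespace IsCrossed

include h

/-- The contraction of a prime of `S` to `R` is the intersection of the conjugates of a prime. -/
theorem exists_isPrime_core_eq {P : Submodule ℤ T} (hP : IsPrimeIn S P) :
    ∃ 𝔮, IsPrimeIn R 𝔮 ∧ P ⊓ R = core u 𝔮 := by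
  -- an ideal maximal among those whose core lies in `P` is prime
  obtain ⟨𝔮, hle, hmax⟩ := zorn_le_nonempty₀ {X | IsIdealIn R X ∧ core u X ≤ P} (by
    intro c hc hchain y hy
    have hne : c.Nonempty := ⟨y, hy⟩
    have hdir := hchain.directedOn
    refine ⟨sSup c, ⟨⟨sSup_le fun X hX => (hc hX).1.le, ?_, ?_⟩, ?_⟩, fun z hz => le_sSup hz⟩
    · rw [sSup_eq_iSup, Submodule.mul_iSup]
      refine iSup_mono fun X => ?_
      rw [Submodule.mul_iSup]; exact iSup_mono fun hX => (hc hX).1.mul_left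
    · rw [sSup_eq_iSup, Submodule.iSup_mul]
      refine iSup_mono fun X => ?_
      rw [Submodule.iSup_mul]; exact iSup_mono fun hX => (hc hX).1.mul_right
    · intro x hx
      have hx' (i : Fin m) : ∃ X ∈ c, x ∈ conj u (s i) X := by
        have := (Submodule.mem_iInf _).1 hx (s i)
        rw [mem_conj, Submodule.mem_sSup_of_directed hne hdir] at this
        obtain ⟨X, hX, hxX⟩ := this
        exact ⟨X, hX, mem_conj u |>.2 hxX⟩
      choose X hX hxX using hx'
      have hub (t : Finset (Fin m)) : ∃ Z ∈ c, ∀ i ∈ t, X i ≤ Z := by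
        classical
        induction t using Finset.induction_on with
        | empty => exact ⟨y, hy, by simp⟩
        | insert a t _ ih =>
          obtain ⟨Z, hZ, hZt⟩ := ih
          obtain ⟨W, hW, h1, h2⟩ := hdir Z hZ (X a) (hX a)
          refine ⟨W, hW, fun i hi => ?_⟩
          rcases Finset.mem_insert.1 hi with rfl | hi
          · exact h2
          · exact (hZt i hi).trans h1
      obtain ⟨Z, hZ, hXZ⟩ := hub Finset.univ
      refine (hc hZ).2 ((Submodule.mem_iInf _).2 fun g => ?_)
      obtain ⟨i, hi⟩ := h.exists_conj_eq (hc hZ).1 g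
      rw [hi]
      exact conj_mono u _ (hXZ i (Finset.mem_univ i)) (hxX i))
    (P ⊓ R) ⟨h.inf_isIdeal hP.isIdeal, (core_le u _).trans inf_le_left⟩
  obtain ⟨⟨hq, hqP⟩, hmax⟩ := hmax
  refine ⟨𝔮, ⟨hq, fun hR => ?_, fun B C hB hC hBC => ?_⟩, le_antisymm ?_ ?_⟩
  · have h1 : 1 ≤ P := h.base_isSubring.one_le.trans ((le_core u h.conj_le hR).trans hqP)
    refine hP.not_le ?_
    calc S = 1 * S := (one_mul S).symm
      _ ≤ P * S := mul_le_mul' h1 le_rfl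
      _ ≤ P := hP.isIdeal.mul_right
  · by_contra! hn
    have hstep (X : Submodule ℤ T) (hX : IsIdealIn R X) (hXq : ¬ X ≤ 𝔮) :
        ¬ core u (𝔮 ⊔ X) ≤ P := fun hle' =>
      hXq (le_sup_right.trans (hmax ⟨hq.sup hX, hle'⟩ le_sup_left))
    have hB' := h.core_isIdeal (hq.sup hB)
    have hC' := h.core_isIdeal (hq.sup hC)
    refine (hP.le_or_le h.isSubring (hB'.le.trans h.le) (hC'.le.trans h.le) ?_).elim
      (hstep B hB hn.1) (hstep C hC hn.2)
    rw [mul_assoc, ← h.invariant_comm hC' (fun g => conj_core_le u g _), ← mul_assoc]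
    refine (mul_le_mul' (le_trans (le_core u (X := 𝔮) (fun g => ?_) ?_) hqP) le_rfl).trans
      hP.isIdeal.mul_right
    · rw [conj_mul]; exact mul_le_mul' (conj_core_le u g _) (conj_core_le u g _)
    · refine (mul_le_mul' (core_le u _) (core_le u _)).trans ?_
      rw [Submodule.sup_mul, Submodule.mul_sup 𝔮, Submodule.mul_sup B]
      refine sup_le (sup_le ?_ ?_) (sup_le ?_ hBC)
      · exact hq.mul_le_left hq.le
      · exact hq.mul_le_left hC.le
      · exact hq.mul_le_right hB.le
  · exact le_core u (fun g => h.conj_inf_le hP.isIdeal g) hle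
  · exact le_inf hqP ((core_le u 𝔮).trans hq.le)

end IsCrossed

end CuttingDown

/-! ### Saturated primes and incomparability -/

section Saturated

variable {T : Type*} [Ring T] {Γ : Type*} [Group Γ] (u : Γ →* Tˣ)

/-- Multiplication by dense ideals is cancellable modulo `K`. -/
def IsSaturated (R S 𝔮 K : Submodule ℤ T) : Prop :=
  ∀ I X, IsDense u R 𝔮 I → X ≤ S → I * X ≤ K → X ≤ K

variable {u} {R S 𝔮 : Submodule ℤ T} {m : ℕ} {s : Fin m → Γ}

namespace IsCrossed

variable (h : IsCrossed u R S s)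

include h

theorem core_mul_isIdeal (hq : IsPrimeIn R 𝔮) : IsIdealIn S (core u 𝔮 * S) :=
  h.invariant_mul_isIdeal (h.core_isIdeal hq.isIdeal) (fun g => conj_core_le u g 𝔮)

theorem isSaturated_of_isPrime {P : Submodule ℤ T} (hP : IsPrimeIn S P)
    (hPq : ∀ I, IsDense u R 𝔮 I → ¬ I ≤ P) : IsSaturated u R S 𝔮 P := by
  intro I X hI hX hIX
  refine (hP.le_or_le h.isSubring (hI.isIdeal.le.trans h.le) hX ?_).resolve_left (hPq I hI)
  rw [h.invariant_comm hI.isIdeal hI.conj_le, mul_assoc]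
  exact (mul_le_mul' le_rfl hIX).trans hP.isIdeal.mul_left

omit h in
theorem not_isDense_le_of_isSaturated {P I : Submodule ℤ T} (hP : IsPrimeIn S P)
    (hsat : IsSaturated u R S 𝔮 P) (hI : IsDense u R 𝔮 I) : ¬ I ≤ P := fun hle =>
  hP.not_le (hsat I S hI le_rfl ((mul_le_mul' hle le_rfl).trans hP.isIdeal.mul_right))

theorem inf_le_core_of_not_isDense_le {P : Submodule ℤ T} (hP : IsIdealIn S P)
    (hPq : ∀ I, IsDense u R 𝔮 I → ¬ I ≤ P) : P ⊓ R ≤ core u 𝔮 := by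
  refine le_core u (fun g => h.conj_inf_le hP g) ?_
  by_contra hn
  exact hPq _ ⟨h.inf_isIdeal hP, fun g => h.conj_inf_le hP g, hn⟩ inf_le_left

variable (hq : IsPrimeIn R 𝔮)

include hq

theorem card_leadSupport_lt {K B : Submodule ℤ T} (hK : IsBimod R K) (hB : IsBimod R B)
    (hKB : K ≤ B) (hBS : B ≤ S) (hA : core u 𝔮 * S ≤ K) (hsat : IsSaturated u R S 𝔮 K)
    (hn : ¬ B ≤ K) : (leadSupport u R s 𝔮 K).card < (leadSupport u R s 𝔮 B).card := by
  refine Finset.card_lt_card ⟨leadSupport_mono hKB, fun hle => hn ?_⟩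
  obtain ⟨I, hI, hIB⟩ := h.exists_isDense_mul_le hq hK hB hKB hBS hA hle
  exact hsat I B hI hBS hIB

/-- Between a saturated ideal and a prime containing it there is a saturated prime. Otherwise the
ideal could be enlarged inside the prime, to a residual, which is again saturated; the rank bounds
the number of such steps. -/
theorem exists_isSaturated_isPrime {P K : Submodule ℤ T} (hP : IsPrimeIn S P)
    (hK : IsIdealIn S K) (hA : core u 𝔮 * S ≤ K) (hsat : IsSaturated u R S 𝔮 K) (hKP : K ≤ P) :
    ∃ P', IsPrimeIn S P' ∧ K ≤ P' ∧ P' ≤ P ∧ IsSaturated u R S 𝔮 P' := by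
  induction hd : m * m - (leadSupport u R s 𝔮 K).card using Nat.strong_induction_on
    generalizing K with
  | _ d ih =>
    by_cases hKprime : IsPrimeIn S K
    · exact ⟨K, hKprime, le_rfl, hKP, hsat⟩
    obtain ⟨B, C, hB, hC, hBC, hBK, hCK⟩ : ∃ B C, IsIdealIn S B ∧ IsIdealIn S C ∧ B * C ≤ K ∧
        ¬ B ≤ K ∧ ¬ C ≤ K := by
      by_contra! hno
      exact hKprime ⟨hK, fun hSK => hP.not_le (hSK.trans hKP), fun B C hB hC hBC =>
        or_iff_not_imp_left.2 (hno B C hB hC hBC)⟩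
    have hbig (B' : Submodule ℤ T) (hB' : IsIdealIn S B') (hKB' : K ≤ B') (hn : ¬ B' ≤ K)
        (hsat' : IsSaturated u R S 𝔮 B') (hle : B' ≤ P) :
        ∃ P', IsPrimeIn S P' ∧ K ≤ P' ∧ P' ≤ P ∧ IsSaturated u R S 𝔮 P' := by
      have hlt := h.card_leadSupport_lt hq (hK.isBimod h.le) (hB'.isBimod h.le) hKB' hB'.le hA
        hsat hn
      have hub : (leadSupport u R s 𝔮 B').card ≤ m * m := by
        simpa using Finset.card_le_univ (leadSupport u R s 𝔮 B')
      obtain ⟨P', h1, h2, h3, h4⟩ := ih _ (by omega) hB' (hA.trans hKB') hsat' hle rfl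
      exact ⟨P', h1, hKB'.trans h2, h3, h4⟩
    -- replace `B` and then `C` by residuals, which are saturated and still have product in `K`
    have hres := leftResidual_mul_le S C K
    have hB' : IsIdealIn S (leftResidual S C K) := by
      refine ⟨leftResidual_le S C K, le_leftResidual.2 ⟨?_, ?_⟩, le_leftResidual.2 ⟨?_, ?_⟩⟩
      · exact (mul_le_mul' le_rfl (leftResidual_le S C K)).trans h.isSubring.mul_le
      · rw [mul_assoc]; exact (mul_le_mul' le_rfl hres).trans hK.mul_left
      · exact (mul_le_mul' (leftResidual_le S C K) le_rfl).trans h.isSubring.mul_le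
      · rw [mul_assoc, hC.left_eq h.isSubring]; exact hres
    have hKB' : K ≤ leftResidual S C K := le_leftResidual.2 ⟨hK.le, hK.mul_le_left hC.le⟩
    have hBB' : B ≤ leftResidual S C K := le_leftResidual.2 ⟨hB.le, hBC⟩
    have hsat' : IsSaturated u R S 𝔮 (leftResidual S C K) := fun I X hI hX hIX =>
      le_leftResidual.2 ⟨hX, hsat I (X * C) hI ((hC.mul_le_right hX).trans hC.le)
        (by rw [← mul_assoc]; exact (le_leftResidual.1 hIX).2)⟩
    set B' := leftResidual S C K
    have hres' := mul_rightResidual_le S B' K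
    have hC' : IsIdealIn S (rightResidual S B' K) := by
      refine ⟨rightResidual_le S B' K, le_rightResidual.2 ⟨?_, ?_⟩, le_rightResidual.2 ⟨?_, ?_⟩⟩
      · exact (mul_le_mul' le_rfl (rightResidual_le S B' K)).trans h.isSubring.mul_le
      · rw [← mul_assoc, hB'.right_eq h.isSubring]; exact hres'
      · exact (mul_le_mul' (rightResidual_le S B' K) le_rfl).trans h.isSubring.mul_le
      · rw [← mul_assoc]; exact (mul_le_mul' hres' le_rfl).trans hK.mul_right
    have hKC' : K ≤ rightResidual S B' K := le_rightResidual.2 ⟨hK.le, hK.mul_le_right hB'.le⟩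
    have hCC' : C ≤ rightResidual S B' K := le_rightResidual.2 ⟨hC.le, hres⟩
    have hsatC' : IsSaturated u R S 𝔮 (rightResidual S B' K) := by
      intro I X hI hX hIX
      obtain ⟨J, hJ, hJB⟩ := h.exists_isDense_mul_le_mul hq hI (hB'.isBimod h.le) hB'.le
        (hA.trans hKB') ((h.core_mul_isIdeal hq).isBimod h.le)
      refine le_rightResidual.2 ⟨hX, hsat J (B' * X) hJ ((hB'.mul_le_left hX).trans hB'.le) ?_⟩
      rw [← mul_assoc]
      refine (mul_le_mul' hJB le_rfl).trans ?_
      rw [Submodule.sup_mul, mul_assoc B']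
      exact sup_le (le_rightResidual.1 hIX).2 ((mul_le_mul' hA le_rfl).trans (hK.mul_le_left hX))
    rcases hP.le_or_le_of_ideals _ _ hB' hC' (hres'.trans hKP) with hle | hle
    · exact hbig B' hB' hKB' (fun hn => hBK (hBB'.trans hn)) hsat' hle
    · exact hbig _ hC' hKC' (fun hn => hCK (hCC'.trans hn)) hsatC' hle

end IsCrossed

end Saturated

section Incomparability

variable {T : Type*} [Ring T] {Γ : Type*} [Group Γ] {u : Γ →* Tˣ}
variable {R S 𝔮 : Submodule ℤ T} {m : ℕ} {s : Fin m → Γ} (h : IsCrossed u R S s)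
  (hq : IsPrimeIn R 𝔮)

namespace IsCrossed

include h

/-- Two elements of `L` with leading terms `a u` and `b u`, where `L` has no elements of smaller
leading term modulo `P`: interchanging the coefficients makes their multiples agree modulo `P`. -/
theorem mul_sub_mul_mem {L P : Submodule ℤ T} {j : Fin m} (hL : IsBimod R L) (hP : IsBimod R P)
    (hLP : L ⊓ (P ⊔ partSpan u R s j.val) ≤ P) {x y a b : T} (hx : x ∈ L) (hy : y ∈ L)
    (ha : a ∈ R) (hb : b ∈ R) (hxa : x - a * (u (s j) : T) ∈ P ⊔ partSpan u R s j.val)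
    (hyb : y - b * (u (s j) : T) ∈ P ⊔ partSpan u R s j.val) :
    x * (↑(u (s j))⁻¹ * b * ↑(u (s j))) - a * y ∈ P := by
  have hW := hP.sup (h.partSpan_isBimod j.val)
  have hb' : (↑(u (s j))⁻¹ * b * ↑(u (s j)) : T) ∈ R := by
    rw [← mem_conj, h.conj_eq_self]; exact hb
  set c : T := (u (s j) : T) with hc
  set b' : T := ↑(u (s j))⁻¹ * b * c with hbdef
  have hcb : c * b' = b * c := by simp [hbdef, hc, mul_assoc]
  have e : x * b' - a * y = (x - a * c) * b' - a * (y - b * c) := by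
    rw [sub_mul, mul_sub, mul_assoc a c b', hcb]; abel
  refine hLP ⟨sub_mem (hL.mul_right (Submodule.mul_mem_mul hx hb'))
    (hL.mul_left (Submodule.mul_mem_mul ha hy)), ?_⟩
  rw [e]
  exact sub_mem (hW.mul_right (Submodule.mul_mem_mul hxa hb'))
    (hW.mul_left (Submodule.mul_mem_mul ha hyb))

include hq

/-- A bimodule `L` strictly above `P` contains one, `X`, whose elements are determined modulo `P`
by their leading coefficient at one unit, and which is killed from the left by one conjugate
of `𝔮`. -/
theorem exists_isotypic_bimod {P L : Submodule ℤ T} (hP : IsIdealIn S P)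
    (hA : core u 𝔮 * S ≤ P) (hsat : IsSaturated u R S 𝔮 P) (hL : IsBimod R L) (hPL : P ≤ L)
    (hLS : L ≤ S) (hn : ¬ L ≤ P) :
    ∃ (j i : Fin m) (X : Submodule ℤ T), IsBimod R X ∧ X ≤ L ∧ ¬ X ≤ P ∧
      X ≤ P ⊔ partSpan u R s (j.val + 1) ∧ L ⊓ (P ⊔ partSpan u R s j.val) ≤ P ∧
      ¬ leadIdeal u R s j X ≤ conj u (s i) 𝔮 ∧ conj u (s i) 𝔮 * X ≤ P := by
  classical
  have hPb : IsBimod R P := hP.isBimod h.le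
  -- `n + 1` is the least number of units whose span meets `L`, modulo `P`, outside `P`
  have hex : ∃ n, ¬ L ⊓ (P ⊔ partSpan u R s n) ≤ P := by
    refine ⟨m, fun hle => hn (le_trans (le_inf le_rfl ?_) hle)⟩
    rw [h.partSpan_eq]; exact hLS.trans le_sup_right
  have hfind := Nat.find_spec hex
  have hfindm : Nat.find hex ≤ m := Nat.find_min' hex (fun hle => hn (by
    refine le_trans (le_inf le_rfl ?_) hle
    rw [h.partSpan_eq]; exact hLS.trans le_sup_right))
  obtain ⟨n, hfn⟩ : ∃ n, Nat.find hex = n + 1 := by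
    refine Nat.exists_eq_succ_of_ne_zero fun h0 => ?_
    rw [h0, partSpan_zero, sup_bot_eq] at hfind
    exact hfind inf_le_right
  have hmin : L ⊓ (P ⊔ partSpan u R s n) ≤ P := by
    by_contra hle
    have := Nat.find_min' hex hle
    omega
  rw [hfn] at hfind hfindm
  let j : Fin m := ⟨n, hfindm⟩
  set X₀ := L ⊓ (P ⊔ partSpan u R s (n + 1)) with hX₀
  have hX₀b : IsBimod R X₀ := hL.inf (hPb.sup (h.partSpan_isBimod _))
  have hPX₀ : P ≤ X₀ := le_inf hPL le_sup_left
  have hAlead : core u 𝔮 ≤ leadIdeal u R s j P :=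
    h.le_leadIdeal ((core_le u 𝔮).trans hq.isIdeal.le) hA j
  obtain ⟨i, hi₀, hiP⟩ : ∃ i, ¬ leadIdeal u R s j X₀ ≤ conj u (s i) 𝔮 ∧
      leadIdeal u R s j P ≤ conj u (s i) 𝔮 := by
    by_contra! hno
    obtain ⟨I, hI, hIle⟩ := h.exists_isDense_mul_le_of_ideals hq (h.leadIdeal_isIdeal hPb j)
      (h.leadIdeal_isIdeal hX₀b j) hAlead hno
    refine hfind (hsat I X₀ hI (inf_le_left.trans hLS) (Submodule.mul_le.2 fun a ha x hx => ?_))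
    exact hmin ⟨hL.mul_left (Submodule.mul_mem_mul (hI.isIdeal.le ha) hx.1),
      h.exists_add_of_leadIdeal (j := j) hPX₀ hI.isIdeal.le hIle ha hx hx.2 hPb⟩
  -- multiplying by the other conjugates of `𝔮` leaves only the part killed by this one
  have hpi := h.conj_isPrime hq (s i)
  obtain ⟨D, hD, hDi, hDle⟩ := hpi.exists_ideal_le h.base_isSubring (fun k => conj u (s k) 𝔮)
    (Finset.univ.filter fun k => conj u (s k) 𝔮 ≠ conj u (s i) 𝔮)
    (fun k _ => h.conj_isIdeal hq.isIdeal _)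
    (fun k hk hle => (Finset.mem_filter.1 hk).2 (h.conj_eq_of_le hq.isIdeal hle))
  have hDb : IsBimod R D := hD.isBimod le_rfl
  have hDX₀ : D * X₀ ≤ X₀ := (mul_le_mul' hD.le le_rfl).trans hX₀b.mul_left
  have hlead : ¬ leadIdeal u R s j (D * X₀) ≤ conj u (s i) 𝔮 := fun hle =>
    (hpi.le_or_le_of_ideals _ _ hD (h.leadIdeal_isIdeal hX₀b j)
      ((h.mul_leadIdeal_le hD.le j).trans hle)).elim hDi hi₀
  refine ⟨j, i, D * X₀, hDb.mul hX₀b, hDX₀.trans inf_le_left, fun hle => ?_,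
    hDX₀.trans inf_le_right, hmin, hlead, ?_⟩
  · exact hlead ((leadIdeal_mono j hle).trans hiP)
  · have hcore : conj u (s i) 𝔮 * D ≤ core u 𝔮 := by
      refine h.le_core_of_forall hq.isIdeal fun k => ?_
      by_cases hk : conj u (s k) 𝔮 = conj u (s i) 𝔮
      · rw [hk]; exact hpi.isIdeal.mul_le_left hD.le
      · exact (mul_le_mul' le_rfl (hDle k (by simp [hk]))).trans
          ((h.conj_isIdeal hq.isIdeal _).mul_le_right hpi.isIdeal.le)
    rw [← mul_assoc]
    exact (mul_le_mul' hcore (inf_le_left.trans hLS)).trans hA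

/-- The annihilator of `X` modulo `P` is, up to denominators, a maximal left ideal, if `X` is as in
`exists_isotypic_bimod` for an `L` that is minimal, up to denominators. -/
theorem exists_isDense_le_sup_leftResidual {P L X Z : Submodule ℤ T} (hP : IsIdealIn S P)
    (hSL : S * L ≤ L) (hLR : L * R ≤ L) (hPL : P ≤ L)
    (hLmin : ∀ L', S * L' ≤ L' → L' * R ≤ L' → P ≤ L' → L' ≤ L → ¬ L' ≤ P →
      ∃ I, IsDense u R 𝔮 I ∧ I * L ≤ L')
    {j i : Fin m} (hX : IsBimod R X) (hXL : X ≤ L)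
    (hXV : X ≤ P ⊔ partSpan u R s (j.val + 1)) (hLP : L ⊓ (P ⊔ partSpan u R s j.val) ≤ P)
    (hXi : ¬ leadIdeal u R s j X ≤ conj u (s i) 𝔮) (hiX : conj u (s i) 𝔮 * X ≤ P)
    (hSZ : S * Z ≤ Z) (hZR : Z * R ≤ Z) (hZS : Z ≤ S) (hZX : ¬ Z * X ≤ P) :
    ∃ I, IsDense u R 𝔮 I ∧ I ≤ Z ⊔ leftResidual S X P := by
  have hPb : IsBimod R P := hP.isBimod h.le
  have hLb : IsBimod R L := ⟨(mul_le_mul' h.le le_rfl).trans hSL, hLR⟩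
  obtain ⟨I, hI, hIL⟩ := hLmin (Z * X ⊔ P)
    (by rw [Submodule.mul_sup, ← mul_assoc]
        exact sup_le_sup (mul_le_mul' hSZ le_rfl) hP.mul_left)
    (by rw [Submodule.sup_mul, mul_assoc]
        exact sup_le_sup (mul_le_mul' le_rfl hX.mul_right) hPb.mul_right)
    le_sup_right (sup_le ((mul_le_mul' hZS hXL).trans hSL) hPL)
    (fun hle => hZX (le_sup_left.trans hle))
  have hrep (x) (hx : x ∈ X) : ∃ a ∈ R, x - a * (u (s j) : T) ∈ P ⊔ partSpan u R s j.val := by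
    have := hXV hx
    rw [partSpan_succ, sup_comm (R * _), ← sup_assoc] at this
    obtain ⟨w, hw, z, hz, rfl⟩ := Submodule.mem_sup.1 this
    obtain ⟨r, hr, rfl⟩ := Submodule.mem_mul_span_singleton.1 hz
    exact ⟨r, hr, by simpa using hw⟩
  -- an element of `Z * X` acts on `X` like an element of `Z`, through leading coefficients
  have htrans (y) (hy : y ∈ Z * X) : ∃ z ∈ Z, ∀ x ∈ X, ∀ b ∈ R,
      x - b * (u (s j) : T) ∈ P ⊔ partSpan u R s j.val →
      y * (↑(u (s j))⁻¹ * b * ↑(u (s j))) - z * x ∈ P := by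
    refine Submodule.mul_induction_on hy (fun z hz x hx => ?_) ?_
    · obtain ⟨a, ha, hxa⟩ := hrep x hx
      refine ⟨z * a, hZR (Submodule.mul_mem_mul hz ha), fun x' hx' b hb hxb => ?_⟩
      have := h.mul_sub_mul_mem hLb hPb hLP (hXL hx) (hXL hx') ha hb hxa hxb
      have := hP.mul_left (Submodule.mul_mem_mul (hZS hz) this)
      rwa [mul_sub, ← mul_assoc, ← mul_assoc z a] at this
    · rintro y₁ y₂ ⟨z₁, hz₁, h₁⟩ ⟨z₂, hz₂, h₂⟩
      refine ⟨z₁ + z₂, add_mem hz₁ hz₂, fun x hx b hb hxb => ?_⟩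
      have := add_mem (h₁ x hx b hb hxb) (h₂ x hx b hb hxb)
      rw [add_mul, add_mul]
      convert this using 1
      abel
  have hIC : I * leadIdeal u R s j X ≤ Z ⊔ leftResidual S X P := by
    refine Submodule.mul_le.2 fun c hc a ha => ?_
    obtain ⟨haR, haX⟩ := mem_leadIdeal.1 ha
    obtain ⟨x, hx, v, hv, hxv⟩ := Submodule.mem_sup.1 haX
    have hxa : x - a * (u (s j) : T) ∈ P ⊔ partSpan u R s j.val := by
      rw [← hxv, sub_add_cancel_left]
      exact neg_mem ((le_sup_right : partSpan u R s j.val ≤ _) hv)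
    obtain ⟨y, hy, p, hp, hyp⟩ := Submodule.mem_sup.1
      (hIL (Submodule.mul_mem_mul hc (hXL hx)))
    obtain ⟨z, hz, hzy⟩ := htrans y hy
    have hcS : c ∈ S := h.le (hI.isIdeal.le hc)
    have hmem : c * a - z ∈ leftResidual S X P := by
      refine ⟨sub_mem (h.isSubring.mul_le (Submodule.mul_mem_mul hcS (h.le haR))) (hZS hz), ?_⟩
      intro x' hx'
      obtain ⟨b, hb, hxb⟩ := hrep x' hx'
      have h1 := hzy x' hx' b hb hxb
      have h2 := hP.mul_left (Submodule.mul_mem_mul hcS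
        (h.mul_sub_mul_mem hLb hPb hLP (hXL hx) (hXL hx') haR hb hxa hxb))
      have hb' : (↑(u (s j))⁻¹ * b * ↑(u (s j)) : T) ∈ R := by
        rw [← mem_conj, h.conj_eq_self]; exact hb
      have h3 := hPb.mul_right (Submodule.mul_mem_mul hp hb')
      have h4 := sub_mem (add_mem h1 h3) h2
      rw [mul_sub, ← mul_assoc c x, ← hyp, ← mul_assoc c a] at h4
      rw [sub_mul]
      convert h4 using 1
      rw [add_mul]; abel
    have := add_mem ((le_sup_right : leftResidual S X P ≤ Z ⊔ _) hmem)
      ((le_sup_left : Z ≤ Z ⊔ leftResidual S X P) hz)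
    rwa [sub_add_cancel] at this
  -- as `X` is killed by one conjugate of `𝔮`, the ideal of leading coefficients only has to avoid
  -- that conjugate
  have hpi := h.conj_isPrime hq (s i)
  have hCi := h.leadIdeal_isIdeal hX j
  obtain ⟨J, hJ, hJle⟩ := h.exists_isDense_le hq (hpi.isIdeal.sup (hI.isIdeal.mul hCi))
    (fun g hle => by
      have := h.conj_eq_of_le hq.isIdeal (le_sup_left.trans hle)
      rw [← this] at hle
      exact (hpi.le_or_le_of_ideals _ _ hI.isIdeal hCi (le_sup_right.trans hle)).elim
        (hI.not_le_conj _) hXi)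
  refine ⟨J, hJ, hJle.trans (sup_le (le_trans ?_ le_sup_right) hIC)⟩
  exact le_leftResidual.2 ⟨hpi.isIdeal.le.trans h.le, hiX⟩

/-- Incomparability: an ideal of `S` strictly containing a prime over `core 𝔮` contains a dense
ideal. A minimal left ideal modulo `P` gives an annihilator `M` that is a maximal left ideal, and
the finitely many translates `M * u (s i)⁻¹` intersect in `P`, so that `S` modulo `P` is semisimple, all
up to denominators. -/
theorem exists_isDense_le_of_lt {P J : Submodule ℤ T} (hP : IsPrimeIn S P)
    (hPq : P ⊓ R = core u 𝔮) (hJ : IsIdealIn S J) (hPJ : P ≤ J) (hn : ¬ J ≤ P) :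
    ∃ I, IsDense u R 𝔮 I ∧ I ≤ J := by
  have hPi := hP.isIdeal
  have hA : core u 𝔮 * S ≤ P := by
    rw [← hPq]; exact (mul_le_mul' inf_le_left le_rfl).trans hPi.mul_right
  have hsat : IsSaturated u R S 𝔮 P := h.isSaturated_of_isPrime hP fun I hI hle =>
    hI.not_le ((le_inf hle hI.isIdeal.le).trans (hPq.le.trans (core_le u 𝔮)))
  have hPb : IsBimod R P := hPi.isBimod h.le
  obtain ⟨L, ⟨hSL, hLR, hPL, hLS, hLn⟩, hLmin⟩ := WellFounded.has_min
    (measure fun X : Submodule ℤ T => (leadSupport u R s 𝔮 X).card).wf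
    {X | S * X ≤ X ∧ X * R ≤ X ∧ P ≤ X ∧ X ≤ S ∧ ¬ X ≤ P}
    ⟨S, h.isSubring.mul_le, (mul_le_mul' le_rfl h.le).trans h.isSubring.mul_le, hPi.le, le_rfl,
      hP.not_le⟩
  have hLb : IsBimod R L := ⟨(mul_le_mul' h.le le_rfl).trans hSL, hLR⟩
  have hLmin' (L') (h1 : S * L' ≤ L') (h2 : L' * R ≤ L') (h3 : P ≤ L') (h4 : L' ≤ L)
      (h5 : ¬ L' ≤ P) : ∃ I, IsDense u R 𝔮 I ∧ I * L ≤ L' := by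
    refine h.exists_isDense_mul_le hq ⟨(mul_le_mul' h.le le_rfl).trans h1, h2⟩ hLb h4 hLS
      (hA.trans h3) ?_
    refine (Finset.eq_of_subset_of_card_le (leadSupport_mono h4) ?_).ge
    exact not_lt.1 (hLmin L' ⟨h1, h2, h3, h4.trans hLS, h5⟩)
  obtain ⟨j, i, X, hX, hXL, hXn, hXV, hLP, hXi, hiX⟩ :=
    h.exists_isotypic_bimod hq hPi hA hsat hLb hPL hLS hLn
  have hmax (Z) (h1 : S * Z ≤ Z) (h2 : Z * R ≤ Z) (h3 : Z ≤ S) (h4 : ¬ Z * X ≤ P) :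
      ∃ I, IsDense u R 𝔮 I ∧ I ≤ Z ⊔ leftResidual S X P :=
    h.exists_isDense_le_sup_leftResidual hq hPi hSL hLR hPL hLmin' hX hXL hXV hLP hXi hiX
      h1 h2 h3 h4
  have hXS : X ≤ S := hXL.trans hLS
  have hMX := leftResidual_mul_le S X P
  have hSM : S * leftResidual S X P ≤ leftResidual S X P := by
    refine le_leftResidual.2 ⟨(mul_le_mul' le_rfl (leftResidual_le S X P)).trans
      h.isSubring.mul_le, ?_⟩
    rw [mul_assoc]; exact (mul_le_mul' le_rfl hMX).trans hPi.mul_left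
  have hMR : leftResidual S X P * R ≤ leftResidual S X P := by
    refine le_leftResidual.2 ⟨(mul_le_mul' (leftResidual_le S X P) h.le).trans
      h.isSubring.mul_le, ?_⟩
    rw [mul_assoc]; exact (mul_le_mul' le_rfl hX.mul_left).trans hMX
  have hMS := leftResidual_le S X P
  -- the proof uses no further property of the annihilator `M` of `X` modulo `P`
  have hMle {Y : Submodule ℤ T} (hY : Y ≤ S) (hYX : Y * X ≤ P) : Y ≤ leftResidual S X P :=
    le_leftResidual.2 ⟨hY, hYX⟩
  generalize leftResidual S X P = M at hmax hMX hSM hMR hMS hMle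
  have hSMu (i : Fin m) : S * (M * unitSpan u (s i)⁻¹) ≤ M * unitSpan u (s i)⁻¹ := by
    rw [← mul_assoc]; exact mul_le_mul' hSM le_rfl
  have hMuR (i : Fin m) : M * unitSpan u (s i)⁻¹ * R ≤ M * unitSpan u (s i)⁻¹ := by
    rw [mul_assoc, h.comm, ← mul_assoc]; exact mul_le_mul' hMR le_rfl
  -- `B` lies in the intersection of the translates of `M` indexed by `t`
  have key (t : Finset (Fin m)) : ∃ B, S * B ≤ B ∧ B * R ≤ B ∧ B ≤ S ∧
      (∀ i ∈ t, B ≤ M * unitSpan u (s i)⁻¹) ∧ ∃ I, IsDense u R 𝔮 I ∧ I ≤ J ⊔ B := by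
    classical
    induction t using Finset.induction_on with
    | empty =>
      exact ⟨S, h.isSubring.mul_le, (mul_le_mul' le_rfl h.le).trans h.isSubring.mul_le, le_rfl,
        by simp, R, h.isDense_self hq, h.le.trans le_sup_right⟩
    | insert a t _ ih =>
      obtain ⟨B, hSB, hBR, hBS, hBt, I, hI, hIB⟩ := ih
      have hSB' : S * (B ⊓ M * unitSpan u (s a)⁻¹) ≤ B ⊓ M * unitSpan u (s a)⁻¹ :=
        le_inf ((mul_le_mul' le_rfl inf_le_left).trans hSB)
          ((mul_le_mul' le_rfl inf_le_right).trans (hSMu a))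
      have hBR' : (B ⊓ M * unitSpan u (s a)⁻¹) * R ≤ B ⊓ M * unitSpan u (s a)⁻¹ :=
        le_inf ((mul_le_mul' inf_le_left le_rfl).trans hBR)
          ((mul_le_mul' inf_le_right le_rfl).trans (hMuR a))
      refine ⟨_, hSB', hBR', inf_le_left.trans hBS, fun i hi => ?_, ?_⟩
      · rcases Finset.mem_insert.1 hi with rfl | hi
        · exact inf_le_right
        · exact inf_le_left.trans (hBt i hi)
      by_cases hBa : B ≤ M * unitSpan u (s a)⁻¹
      · exact ⟨I, hI, by rwa [inf_eq_left.2 hBa]⟩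
      have hBuS : B * unitSpan u (s a) ≤ S :=
        (mul_le_mul' hBS (h.unitSpan_le _)).trans h.isSubring.mul_le
      have hBu : ¬ B * unitSpan u (s a) * X ≤ P := fun hle =>
        hBa ((_root_.CrossedExt.mul_unitSpan_le u).1 (hMle hBuS hle))
      have hJBX : ¬ J * (B * unitSpan u (s a)) * X ≤ P := fun hle => by
        refine (hP.le_or_le h.isSubring hJ.le
          ((mul_le_mul' hBuS hXS).trans h.isSubring.mul_le) ?_).elim hn hBu
        rwa [hJ.right_eq h.isSubring, ← mul_assoc]
      obtain ⟨I', hI', hI'le⟩ := hmax (J * (B * unitSpan u (s a)))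
        (by rw [← mul_assoc]; exact mul_le_mul' hJ.mul_left le_rfl)
        (by rw [mul_assoc, mul_assoc B, h.comm, ← mul_assoc B]
            exact mul_le_mul' le_rfl (mul_le_mul' hBR le_rfl))
        ((hJ.mul_le_left hBuS).trans hJ.le) hJBX
      -- translate the inclusion by the unit `u (s a)`
      have hSN : S * (J * B ⊔ M * unitSpan u (s a)⁻¹) ≤ J * B ⊔ M * unitSpan u (s a)⁻¹ := by
        rw [Submodule.mul_sup, ← mul_assoc]
        exact sup_le_sup (mul_le_mul' hJ.mul_left le_rfl) (hSMu a)
      have hI'N : I' ≤ J * B ⊔ M * unitSpan u (s a)⁻¹ := by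
        have h1 : I' ≤ conj u (s a) I' := by
          have := (conj_le_iff u (s a)⁻¹).1 (hI'.conj_le (s a)⁻¹)
          rwa [inv_inv] at this
        have h2 : I' * unitSpan u (s a)⁻¹ ≤ J * B ⊔ M * unitSpan u (s a)⁻¹ := by
          refine (mul_le_mul' hI'le le_rfl).trans ?_
          rw [Submodule.sup_mul, mul_assoc, mul_assoc B, unitSpan_mul_inv, mul_one]
        refine h1.trans ?_
        rw [conj, mul_assoc]
        exact (mul_le_mul' (h.unitSpan_le _) h2).trans hSN
      refine ⟨I' * I, hI'.mul hq hI, (mul_le_mul' le_rfl hIB).trans ?_⟩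
      rw [Submodule.mul_sup]
      have hI'S : I' ≤ S := hI'.isIdeal.le.trans h.le
      refine sup_le ((hJ.mul_le_right hI'S).trans le_sup_left) ?_
      have hJB : J * B ≤ B := (mul_le_mul' hJ.le le_rfl).trans hSB
      have h3 : I' * B ≤ (J * B ⊔ M * unitSpan u (s a)⁻¹) ⊓ B := by
        refine le_inf ?_ ((mul_le_mul' hI'S le_rfl).trans hSB)
        refine (mul_le_mul' le_rfl hBS).trans ?_
        rw [h.invariant_comm hI'.isIdeal hI'.conj_le]
        exact (mul_le_mul' le_rfl hI'N).trans hSN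
      rw [sup_inf_assoc_of_le _ hJB, inf_comm] at h3
      exact h3.trans (sup_le_sup (hJ.mul_le_left hBS) le_rfl)
  obtain ⟨B, hSB, hBR, hBS, hBM, I, hI, hIB⟩ := key Finset.univ
  refine ⟨I, hI, hIB.trans (sup_le le_rfl (le_trans ?_ hPJ))⟩
  refine (hP.le_or_le h.isSubring hBS hXS ?_).resolve_right hXn
  rw [h.eq_iSup, Submodule.mul_iSup, Submodule.iSup_mul]
  refine iSup_le fun k => ?_
  rw [← mul_assoc]
  refine (mul_le_mul' (mul_le_mul' hBR le_rfl) le_rfl).trans (le_trans ?_ hMX)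
  exact mul_le_mul' ((_root_.CrossedExt.mul_unitSpan_le u).2 (hBM k (Finset.mem_univ k))) le_rfl

end IsCrossed

end Incomparability

/-! ### Heights of primes in crossed products -/

section Height

/-- If going down holds along a relation, then heights do not decrease along it. -/
theorem height_le_height_of_rel {α β : Type*} [Preorder α] [Preorder β] {r : α → β → Prop}
    (hr : ∀ a b, r a b → ∀ a' < a, ∃ b' < b, r a' b') {a : α} {b : β} (hab : r a b) :
    Order.height a ≤ Order.height b := by
  have key (n : ℕ) : ∀ a b, r a b → Order.height b ≤ n → Order.height a ≤ n := by
    induction n with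
    | zero =>
      intro a b hab hb
      rw [Order.height_le_coe_iff] at hb ⊢
      intro a' ha'
      obtain ⟨b', hb', -⟩ := hr a b hab a' ha'
      exact absurd (hb b' hb') (by simp)
    | succ n ih =>
      intro a b hab hb
      rw [Order.height_le_coe_iff] at hb ⊢
      intro a' ha'
      obtain ⟨b', hb', hab'⟩ := hr a b hab a' ha'
      have h1 : Order.height b' ≤ n := by
        have := hb b' hb'
        rw [Nat.cast_add, Nat.cast_one] at this
        exact Order.le_of_lt_add_one this
      exact (ih a' b' hab' h1).trans_lt (by exact_mod_cast Nat.lt_succ_self n)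
  cases hb : Order.height b with
  | top => exact le_top
  | coe n => exact key n a b hab hb.le

variable {T : Type*} [Ring T] {Γ : Type*} [Group Γ] {u : Γ →* Tˣ}

theorem mem_iSup_mul_unitSpan {Y : Submodule ℤ T} {m : ℕ} {s : Fin m → Γ} {x : T} :
    x ∈ ⨆ i, Y * unitSpan u (s i) ↔
      ∃ f : Fin m → T, (∀ i, f i ∈ Y) ∧ ∑ i, f i * (u (s i) : T) = x := by
  classical
  constructor
  · intro hx
    refine Submodule.iSup_induction (fun i => Y * unitSpan u (s i))
      (motive := fun x => ∃ f : Fin m → T, (∀ i, f i ∈ Y) ∧ ∑ i, f i * (u (s i) : T) = x) hx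
      (fun i y hy => ?_) ⟨0, fun _ => zero_mem _, by simp⟩ ?_
    · obtain ⟨r, hr, rfl⟩ := Submodule.mem_mul_span_singleton.1 hy
      refine ⟨Pi.single i r, fun k => ?_, ?_⟩
      · by_cases hk : k = i
        · subst hk; simpa using hr
        · simp [hk]
      · rw [Finset.sum_eq_single i] <;> simp +contextual
    · rintro _ _ ⟨f, hf, rfl⟩ ⟨g, hg, rfl⟩
      exact ⟨f + g, fun i => add_mem (hf i) (hg i), by simp [add_mul, Finset.sum_add_distrib]⟩
  · rintro ⟨f, hf, rfl⟩
    exact sum_mem fun i _ => (le_iSup (fun i => Y * unitSpan u (s i)) i)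
      (Submodule.mul_mem_mul (hf i) (mem_unitSpan u _))

/-- Cancellation of `I` modulo `C` passes to a free module with basis a family of units. -/
theorem le_iSup_of_mul_le_iSup {R I C X : Submodule ℤ T} {m : ℕ} {s : Fin m → Γ}
    (hR : IsSubringIn R)
    (free : ∀ r : Fin m → T, (∀ i, r i ∈ R) → ∑ i, r i * (u (s i) : T) = 0 → ∀ i, r i = 0)
    (hI : I ≤ R) (hC : C ≤ R) (hIC : ∀ Y ≤ R, I * Y ≤ C → Y ≤ C)
    (hX : X ≤ ⨆ i, R * unitSpan u (s i)) (hIX : I * X ≤ ⨆ i, C * unitSpan u (s i)) :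
    X ≤ ⨆ i, C * unitSpan u (s i) := by
  intro x hx
  obtain ⟨f, hf, rfl⟩ := mem_iSup_mul_unitSpan.1 (hX hx)
  refine mem_iSup_mul_unitSpan.2 ⟨f, fun i => ?_, rfl⟩
  refine (Submodule.span_singleton_le_iff_mem _ _).1 (hIC (span ℤ {f i})
    ((Submodule.span_singleton_le_iff_mem _ _).2 (hf i)) (Submodule.mul_le.2 fun a ha y hy => ?_))
  obtain ⟨n, rfl⟩ := Submodule.mem_span_singleton.1 hy
  rw [mul_smul_comm]
  refine C.smul_mem n ?_
  obtain ⟨c, hc, hce⟩ := mem_iSup_mul_unitSpan.1 (hIX (Submodule.mul_mem_mul ha hx))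
  have := free (fun i => a * f i - c i) (fun i => sub_mem
    (hR.mul_le (Submodule.mul_mem_mul (hI ha) (hf i))) (hC (hc i))) (by
      simp only [sub_mul, Finset.sum_sub_distrib, hce, Finset.mul_sum, mul_assoc, sub_self]) i
  rw [sub_eq_zero.1 this]; exact hc i

variable {R S 𝔮 : Submodule ℤ T} {m : ℕ} {s : Fin m → Γ}

namespace IsCrossed

variable (h : IsCrossed u R S s)

include h

theorem ideal_mul_eq_iSup {C : Submodule ℤ T} (hC : IsIdealIn R C) :
    C * S = ⨆ i, C * unitSpan u (s i) := by
  rw [h.eq_iSup, Submodule.mul_iSup]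
  exact iSup_congr fun i => by rw [← mul_assoc, hC.right_eq h.base_isSubring]

theorem core_mul_isSaturated (hq : IsPrimeIn R 𝔮) : IsSaturated u R S 𝔮 (core u 𝔮 * S) := by
  intro I X hI hXS hIX
  have hA := h.core_isIdeal hq.isIdeal
  rw [h.ideal_mul_eq_iSup hA] at hIX ⊢
  refine le_iSup_of_mul_le_iSup h.base_isSubring h.free hI.isIdeal.le hA.le (fun Y hY hIY => ?_)
    (hXS.trans h.eq_iSup.le) hIX
  refine le_iInf fun g => ?_
  refine ((h.conj_isPrime hq g).le_or_le h.base_isSubring hI.isIdeal.le hY ?_).resolve_left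
    (hI.not_le_conj g)
  rw [hI.isIdeal.right_eq h.base_isSubring]
  exact hIY.trans (iInf_le _ g)

theorem exists_lt_of_prime_lt {P P' : Submodule ℤ T} (hP : IsPrimeIn S P)
    (hP' : IsPrimeIn S P') (hq : IsPrimeIn R 𝔮) (hPq : P ⊓ R = core u 𝔮) (hlt : P' < P) :
    ∃ 𝔮', IsPrimeIn R 𝔮' ∧ 𝔮' < 𝔮 ∧ P' ⊓ R = core u 𝔮' := by
  obtain ⟨𝔮₁, hq₁, he₁⟩ := h.exists_isPrime_core_eq hP'
  have hle : core u 𝔮₁ ≤ 𝔮 := by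
    rw [← he₁]
    exact (inf_le_inf hlt.le le_rfl).trans (hPq.le.trans (core_le u 𝔮))
  obtain ⟨i, hi⟩ : ∃ i, conj u (s i) 𝔮₁ ≤ 𝔮 := by
    by_contra! hno
    obtain ⟨Y, -, hYq, hY⟩ := hq.exists_ideal_le h.base_isSubring
      (fun i => conj u (s i) 𝔮₁) Finset.univ
      (fun i _ => h.conj_isIdeal hq₁.isIdeal _) (fun i _ => hno i)
    exact hYq ((h.le_core_of_forall hq₁.isIdeal fun i => hY i (Finset.mem_univ i)).trans hle)
  have he : P' ⊓ R = core u (conj u (s i) 𝔮₁) := by rw [he₁, core_conj]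
  refine ⟨_, h.conj_isPrime hq₁ (s i), lt_of_le_not_ge hi fun hge => ?_, he⟩
  obtain ⟨I, hI, hIP⟩ := h.exists_isDense_le_of_lt (h.conj_isPrime hq₁ (s i)) hP' he hP.isIdeal
    hlt.le (not_le_of_gt hlt)
  exact hI.not_le ((le_inf hIP hI.isIdeal.le).trans (hPq.le.trans ((core_le u 𝔮).trans hge)))

theorem exists_prime_lt_of_lt {P 𝔮' : Submodule ℤ T} (hP : IsPrimeIn S P)
    (hq : IsPrimeIn R 𝔮) (hq' : IsPrimeIn R 𝔮') (hPq : P ⊓ R = core u 𝔮) (hlt : 𝔮' < 𝔮) :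
    ∃ P', IsPrimeIn S P' ∧ P' < P ∧ P' ⊓ R = core u 𝔮' := by
  have hle : core u 𝔮' * S ≤ P :=
    (mul_le_mul' ((core_mono u hlt.le).trans (hPq.ge.trans inf_le_left)) le_rfl).trans
      hP.isIdeal.mul_right
  obtain ⟨P', hP', hKP', hP'P, hsat⟩ := h.exists_isSaturated_isPrime hq' hP
    (h.core_mul_isIdeal hq') le_rfl (h.core_mul_isSaturated hq') hle
  have he : P' ⊓ R = core u 𝔮' := le_antisymm
    (h.inf_le_core_of_not_isDense_le hP'.isIdeal fun I hI =>
      not_isDense_le_of_isSaturated hP' hsat hI)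
    (le_inf ((h.isSubring.le_mul' _).trans hKP') ((core_le u 𝔮').trans hq'.isIdeal.le))
  refine ⟨P', hP', lt_of_le_of_ne hP'P ?_, he⟩
  rintro rfl
  -- equal cores would put a conjugate of `𝔮` inside `𝔮'`, hence strictly inside `𝔮`
  obtain ⟨i, hi⟩ : ∃ i, conj u (s i) 𝔮 ≤ 𝔮' := by
    by_contra! hno
    obtain ⟨Y, -, hYq, hY⟩ := hq'.exists_ideal_le h.base_isSubring
      (fun i => conj u (s i) 𝔮) Finset.univ
      (fun i _ => h.conj_isIdeal hq.isIdeal _) (fun i _ => hno i)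
    refine hYq ((h.le_core_of_forall hq.isIdeal fun i => hY i (Finset.mem_univ i)).trans ?_)
    rw [← hPq, he]; exact core_le u 𝔮'
  have h1 : conj u (s i) 𝔮 ≤ conj u 1 𝔮 := by rw [conj_one]; exact hi.trans hlt.le
  have h2 := h.conj_eq_of_le hq.isIdeal h1
  rw [conj_one] at h2
  rw [h2] at hi
  exact absurd hlt (not_lt_of_ge hi)

/-- A prime of a crossed product over `core 𝔮` has the same height as `𝔮`. -/
theorem height_eq {P : Submodule ℤ T} (hP : IsPrimeIn S P) (hq : IsPrimeIn R 𝔮)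
    (hPq : P ⊓ R = core u 𝔮) :
    Order.height (⟨P, hP⟩ : {P // IsPrimeIn S P}) =
      Order.height (⟨𝔮, hq⟩ : {P // IsPrimeIn R P}) := by
  apply le_antisymm
  · refine height_le_height_of_rel
      (r := fun (P : {P // IsPrimeIn S P}) (𝔮 : {P // IsPrimeIn R P}) => P.1 ⊓ R = core u 𝔮.1)
      (fun P 𝔮 hr P' hlt => ?_) hPq
    obtain ⟨𝔮', hq', hlt', he⟩ := h.exists_lt_of_prime_lt P.2 P'.2 𝔮.2 hr hlt
    exact ⟨⟨𝔮', hq'⟩, hlt', he⟩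
  · refine height_le_height_of_rel
      (r := fun (𝔮 : {P // IsPrimeIn R P}) (P : {P // IsPrimeIn S P}) => P.1 ⊓ R = core u 𝔮.1)
      (fun 𝔮 P hr 𝔮' hlt => ?_) hPq
    obtain ⟨P', hP', hlt', he⟩ := h.exists_prime_lt_of_lt P.2 𝔮.2 𝔮'.2 hr hlt
    exact ⟨⟨P', hP'⟩, hlt', he⟩

end IsCrossed

theorem conj_comp {Γ' : Type*} [Group Γ'] (φ : Γ' →* Γ) (g : Γ') (X : Submodule ℤ T) :
    conj (u.comp φ) g X = conj u (φ g) X := by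
  simp only [conj, unitSpan, MonoidHom.comp_apply, map_inv]

/-- Let `S ⊆ T` be crossed products over the same `R`, with `T` free over `S` on a family of units.
A prime of `T` minimal over the ideal induced from a prime `Q` of `S` has the height of `Q`. The
induced ideal is saturated, so that both primes lie over conjugates of one prime of `R`. -/
theorem height_eq_of_minimal_induced {Γ' : Type*} [Group Γ'] {φ : Γ' →* Γ} {m' l : ℕ}
    {s' : Fin m' → Γ'} {t : Fin l → Γ} (hT : IsCrossed u R ⊤ s)
    (hS : IsCrossed (u.comp φ) R S s') (hspan : ⊤ = ⨆ j, S * unitSpan u (t j))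
    (free : ∀ r : Fin l → T, (∀ i, r i ∈ S) → ∑ i, r i * (u (t i) : T) = 0 → ∀ i, r i = 0)
    {Q P : Submodule ℤ T} (hQ : IsPrimeIn S Q) (hP : IsPrimeIn ⊤ P)
    (hQP : rightResidual ⊤ ⊤ (Q * ⊤) ≤ P)
    (hmin : ∀ P', IsPrimeIn ⊤ P' → rightResidual ⊤ ⊤ (Q * ⊤) ≤ P' → P' ≤ P → P' = P) :
    Order.height (⟨P, hP⟩ : {P : Submodule ℤ T // IsPrimeIn ⊤ P}) =
      Order.height (⟨Q, hQ⟩ : {P // IsPrimeIn S P}) := by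
  obtain ⟨𝔮, hq, hQq⟩ := hS.exists_isPrime_core_eq hQ
  set K := rightResidual ⊤ ⊤ (Q * ⊤) with hK
  have htt : (⊤ : Submodule ℤ T) * ⊤ ≤ ⊤ := le_top
  have hKmul : ⊤ * K ≤ Q * ⊤ := mul_rightResidual_le ⊤ ⊤ (Q * ⊤)
  have hleK {X : Submodule ℤ T} (hX : ⊤ * X ≤ Q * ⊤) : X ≤ K := le_rightResidual.2 ⟨le_top, hX⟩
  have hKi : IsIdealIn ⊤ K := by
    refine ⟨le_top, hleK ?_, hleK ?_⟩
    · rw [← mul_assoc]; exact (mul_le_mul' htt le_rfl).trans hKmul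
    · rw [← mul_assoc]
      refine (mul_le_mul' hKmul le_rfl).trans ?_
      rw [mul_assoc]; exact mul_le_mul' le_rfl htt
  have hcore : core u 𝔮 ≤ core (u.comp φ) 𝔮 := le_iInf fun g =>
    (iInf_le (fun x => conj u x 𝔮) (φ g)).trans (conj_comp φ g 𝔮).ge
  have hcoreQ : core u 𝔮 ≤ Q := hcore.trans (hQq.ge.trans inf_le_left)
  have hA : core u 𝔮 * ⊤ ≤ K := by
    refine hleK ?_
    rw [← mul_assoc, ← hT.invariant_comm (hT.core_isIdeal hq.isIdeal)
      (fun g => conj_core_le u g 𝔮), mul_assoc]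
    exact mul_le_mul' hcoreQ htt
  have hQT : Q * ⊤ = ⨆ j, Q * unitSpan u (t j) := by
    rw [hspan, Submodule.mul_iSup]
    exact iSup_congr fun i => by rw [← mul_assoc, hQ.isIdeal.right_eq hS.isSubring]
  have hsat : IsSaturated u R ⊤ 𝔮 K := by
    intro I X hI _ hIX
    refine hleK ?_
    have hIX' : I * (⊤ * X) ≤ Q * ⊤ := by
      rw [← mul_assoc, hT.invariant_comm hI.isIdeal hI.conj_le, mul_assoc]
      exact (mul_le_mul' le_rfl hIX).trans hKmul
    rw [hQT] at hIX' ⊢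
    refine le_iSup_of_mul_le_iSup hS.isSubring free (hI.isIdeal.le.trans hS.le) hQ.isIdeal.le
      (fun Y hY hIY => ?_) (le_top.trans hspan.le) hIX'
    refine (hQ.le_or_le hS.isSubring (hI.isIdeal.le.trans hS.le) hY ?_).resolve_left fun hle => ?_
    · rw [hS.invariant_comm hI.isIdeal (fun g => (conj_comp φ g I).le.trans (hI.conj_le (φ g))),
        mul_assoc]
      exact (mul_le_mul' le_rfl hIY).trans hQ.isIdeal.mul_left
    · exact hI.not_le ((le_inf hle hI.isIdeal.le).trans (hQq.le.trans (core_le _ 𝔮)))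
  obtain ⟨P', hP', hKP', hP'P, hsatP'⟩ := hT.exists_isSaturated_isPrime hq hP hKi hA hsat hQP
  obtain rfl := hmin P' hP' hKP' hP'P
  have hPq : P' ⊓ R = core u 𝔮 := le_antisymm
    (hT.inf_le_core_of_not_isDense_le hP'.isIdeal fun I hI =>
      IsCrossed.not_isDense_le_of_isSaturated hP' hsatP' hI)
    (le_inf ((hT.isSubring.le_mul' _).trans (hA.trans hKP')) ((core_le u 𝔮).trans hq.isIdeal.le))
  rw [hT.height_eq hP' hq hPq, hS.height_eq hQ hq hQq]

end Height

/-! ### Two-sided ideals and their images -/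

section Transfer

variable {A T : Type*} [Ring A] [Ring T] (f : A →+* T)

/-- The image in `T` of a two-sided ideal of `A`, as an additive subgroup. -/
def imageSubmodule (I : TwoSidedIdeal A) : Submodule ℤ T where
  carrier := f '' I
  add_mem' := by
    rintro _ _ ⟨a, ha, rfl⟩ ⟨b, hb, rfl⟩
    exact ⟨a + b, I.add_mem ha hb, map_add f a b⟩
  zero_mem' := ⟨0, I.zero_mem, map_zero f⟩
  smul_mem' := by
    rintro n _ ⟨a, ha, rfl⟩
    exact ⟨n • a, I.zsmul_mem n ha, map_zsmul f n a⟩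

variable {f}

theorem mem_imageSubmodule {I : TwoSidedIdeal A} {x : T} :
    x ∈ imageSubmodule f I ↔ ∃ a ∈ I, f a = x := Iff.rfl

theorem imageSubmodule_isIdeal (I : TwoSidedIdeal A) :
    IsIdealIn (imageSubmodule f ⊤) (imageSubmodule f I) where
  le := by rintro _ ⟨a, -, rfl⟩; exact ⟨a, trivial, rfl⟩
  mul_left := Submodule.mul_le.2 (by
    rintro _ ⟨a, -, rfl⟩ _ ⟨b, hb, rfl⟩
    exact ⟨a * b, I.mul_mem_left a b hb, map_mul f a b⟩)
  mul_right := Submodule.mul_le.2 (by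
    rintro _ ⟨a, ha, rfl⟩ _ ⟨b, -, rfl⟩
    exact ⟨a * b, I.mul_mem_right a b ha, map_mul f a b⟩)

theorem exists_imageSubmodule_eq {X : Submodule ℤ T} (hX : IsIdealIn (imageSubmodule f ⊤) X) :
    ∃ I : TwoSidedIdeal A, imageSubmodule f I = X := by
  have hf (a : A) : f a ∈ imageSubmodule f ⊤ := ⟨a, trivial, rfl⟩
  refine ⟨TwoSidedIdeal.mk' {a | f a ∈ X} (by simp)
    (fun ha hb => by
      simp only [Set.mem_ofPred_eq, map_add] at *
      exact add_mem ha hb)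
    (fun ha => by
      simp only [Set.mem_ofPred_eq, map_neg] at *
      exact neg_mem ha)
    (fun {a b} hb => by
      simp only [Set.mem_ofPred_eq, map_mul] at *
      exact hX.mul_left (Submodule.mul_mem_mul (hf a) hb))
    (fun {a b} ha => by
      simp only [Set.mem_ofPred_eq, map_mul] at *
      exact hX.mul_right (Submodule.mul_mem_mul ha (hf b))), ?_⟩
  ext x
  rw [mem_imageSubmodule]
  constructor
  · rintro ⟨a, ha, rfl⟩
    rw [TwoSidedIdeal.mem_mk'] at ha
    exact ha
  · intro hx
    obtain ⟨a, -, rfl⟩ := hX.le hx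
    exact ⟨a, by rw [TwoSidedIdeal.mem_mk']; exact hx, rfl⟩

variable (hf : Function.Injective f)

include hf

theorem map_mem_imageSubmodule {I : TwoSidedIdeal A} {a : A} :
    f a ∈ imageSubmodule f I ↔ a ∈ I :=
  ⟨fun ⟨_, hb, hab⟩ => hf hab ▸ hb, fun ha => ⟨a, ha, rfl⟩⟩

theorem imageSubmodule_le {I J : TwoSidedIdeal A} :
    imageSubmodule f I ≤ imageSubmodule f J ↔ I ≤ J :=
  ⟨fun h _ ha => (map_mem_imageSubmodule hf).1 (h ⟨_, ha, rfl⟩),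
    fun h _ ⟨a, ha, hax⟩ => ⟨a, h ha, hax⟩⟩

theorem imageSubmodule_mul_le {I J K : TwoSidedIdeal A} :
    imageSubmodule f I * imageSubmodule f J ≤ imageSubmodule f K ↔
      ∀ a ∈ I, ∀ b ∈ J, a * b ∈ K := by
  rw [Submodule.mul_le]
  constructor
  · intro h a ha b hb
    rw [← map_mem_imageSubmodule hf, map_mul]
    exact h _ ⟨a, ha, rfl⟩ _ ⟨b, hb, rfl⟩
  · rintro h _ ⟨a, ha, rfl⟩ _ ⟨b, hb, rfl⟩
    rw [← map_mul, map_mem_imageSubmodule hf]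
    exact h a ha b hb

theorem isPrimeIn_imageSubmodule {P : TwoSidedIdeal A} :
    IsPrimeIn (imageSubmodule f ⊤) (imageSubmodule f P) ↔ IsPrimeTwoSided P := by
  constructor
  · intro h
    refine ⟨fun htop => h.not_le (by rw [htop]), fun B C hBC => ?_⟩
    rw [← imageSubmodule_le hf, ← imageSubmodule_le hf]
    exact h.le_or_le_of_ideals _ _ (imageSubmodule_isIdeal B) (imageSubmodule_isIdeal C)
      ((imageSubmodule_mul_le hf).2 hBC)
  · rintro ⟨hne, h⟩
    refine ⟨imageSubmodule_isIdeal P, fun hle => hne ?_, fun B C hB hC hBC => ?_⟩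
    · exact top_le_iff.1 ((imageSubmodule_le hf).1 hle)
    · obtain ⟨B, rfl⟩ := exists_imageSubmodule_eq hB
      obtain ⟨C, rfl⟩ := exists_imageSubmodule_eq hC
      rw [imageSubmodule_le hf, imageSubmodule_le hf]
      exact h B C ((imageSubmodule_mul_le hf).1 hBC)

theorem primeHeight_eq {P : TwoSidedIdeal A} (hP : IsPrimeTwoSided P)
    (hP' : IsPrimeIn (imageSubmodule f ⊤) (imageSubmodule f P)) :
    primeHeight ⟨P, hP⟩ =
      Order.height (⟨_, hP'⟩ : {X // IsPrimeIn (imageSubmodule f ⊤) X}) := by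
  let e : PrimeTwoSidedIdeal A ↪o {X // IsPrimeIn (imageSubmodule f ⊤) X} :=
    OrderEmbedding.ofMapLEIff
      (fun P => ⟨imageSubmodule f P.1, (isPrimeIn_imageSubmodule hf).2 P.2⟩)
      (fun P Q => imageSubmodule_le hf)
  have he : Function.Surjective e := by
    rintro ⟨X, hX⟩
    obtain ⟨I, rfl⟩ := exists_imageSubmodule_eq hX.isIdeal
    exact ⟨⟨I, (isPrimeIn_imageSubmodule hf).1 hX⟩, rfl⟩
  have h1 := Order.height_orderIso (RelIso.ofSurjective e he) ⟨P, hP⟩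
  rw [primeHeight, ← Order.height_eq_iSup_last_eq, ← h1]
  rfl

end Transfer

theorem mul_mem_mul_top {T : Type*} [Ring T] {X : Submodule ℤ T} {y : T} (hy : y ∈ X * ⊤) (a : T) :
    y * a ∈ X * ⊤ := by
  have := Submodule.mul_mem_mul hy (show a ∈ (⊤ : Submodule ℤ T) from trivial)
  rw [mul_assoc] at this
  exact mul_le_mul' (le_refl X) (le_top : (⊤ * ⊤ : Submodule ℤ T) ≤ ⊤) this

section Induced

variable {k : Type*} [Field k] {G : Type*} [Group G] [TopologicalSpace G]

theorem mem_extendedRightIdeal {H : OpenSubgroup G}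
    (L : TwoSidedIdeal (CompletedGroupAlgebra k H)) {x : CompletedGroupAlgebra k G} :
    x ∈ extendedRightIdeal L ↔
      x ∈ imageSubmodule (completedInclusion k H).toRingHom L * ⊤ := by
  constructor
  · intro hx
    refine Submodule.span_induction ?_ (zero_mem _) (fun _ _ _ _ => add_mem) ?_ hx
    · rintro _ ⟨y, hy, rfl⟩
      rw [← mul_one (completedInclusion k H y)]
      exact Submodule.mul_mem_mul ⟨y, hy, rfl⟩ trivial
    · intro a y _ hy
      exact mul_mem_mul_top hy a.unop
  · intro hx
    refine Submodule.mul_induction_on hx ?_ (fun _ _ => add_mem)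
    rintro _ ⟨y, hy, rfl⟩ a -
    exact (extendedRightIdeal L).smul_mem (MulOpposite.op a)
      (Submodule.subset_span ⟨y, hy, rfl⟩)

theorem imageSubmodule_id_inducedIdeal {H : OpenSubgroup G}
    (Q : TwoSidedIdeal (CompletedGroupAlgebra k H)) :
    imageSubmodule (RingHom.id _) (inducedIdeal Q) = rightResidual ⊤ ⊤
      (imageSubmodule (completedInclusion k H).toRingHom Q * ⊤) := by
  ext x
  rw [mem_imageSubmodule]
  constructor
  · rintro ⟨x, hx, rfl⟩
    exact ⟨trivial, fun a _ => (mem_extendedRightIdeal Q).1 ((mem_inducedIdeal Q _).1 hx a)⟩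
  · rintro ⟨-, hx⟩
    exact ⟨x, (mem_inducedIdeal Q x).2 fun a => (mem_extendedRightIdeal Q).2 (hx a trivial), rfl⟩

end Induced

/-! ### Completed group algebras and restriction of coefficients -/

section Concrete

variable {k : Type*} [Field k] {G : Type*} [Group G] [TopologicalSpace G]

theorem transition_single {N M : OpenNormalSubgroup G} (h : N ≤ M) (g : G) (a : k) :
    groupAlgebraTransition k G h (MonoidAlgebra.single (g : G ⧸ N.toSubgroup) a) =
      MonoidAlgebra.single (g : G ⧸ M.toSubgroup) a :=
  MonoidAlgebra.mapDomain_single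

theorem inclusion_single (K : OpenSubgroup G) (M : OpenNormalSubgroup G) (g : K) (a : k) :
    groupAlgebraInclusion k K M (MonoidAlgebra.single (g : K ⧸ (M.restrict K).toSubgroup) a) =
      MonoidAlgebra.single ((g : G) : G ⧸ M.toSubgroup) a :=
  MonoidAlgebra.mapDomain_single

theorem induction_mk {M : OpenNormalSubgroup G} {p : MonoidAlgebra k (G ⧸ M.toSubgroup) → Prop}
    (x : MonoidAlgebra k (G ⧸ M.toSubgroup)) (zero : p 0) (add : ∀ x y, p x → p y → p (x + y))
    (single : ∀ (g : G) (a : k), p (MonoidAlgebra.single (g : G ⧸ M.toSubgroup) a)) : p x := by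
  refine MonoidAlgebra.induction_linear x zero add fun q a => ?_
  obtain ⟨g, rfl⟩ := QuotientGroup.mk_surjective q
  exact single g a

theorem transition_trans {N M L : OpenNormalSubgroup G} (h : N ≤ M) (h' : M ≤ L)
    (x : MonoidAlgebra k (G ⧸ N.toSubgroup)) :
    groupAlgebraTransition k G h' (groupAlgebraTransition k G h x) =
      groupAlgebraTransition k G (h.trans h') x := by
  induction x using induction_mk with
  | zero => simp only [map_zero]
  | add x y hx hy => simp only [map_add, hx, hy]
  | single g a => simp only [transition_single]

theorem transition_refl {M : OpenNormalSubgroup G} (h : M ≤ M)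
    (x : MonoidAlgebra k (G ⧸ M.toSubgroup)) : groupAlgebraTransition k G h x = x := by
  induction x using induction_mk with
  | zero => simp only [map_zero]
  | add x y hx hy => simp only [map_add, hx, hy]
  | single g a => simp only [transition_single]

theorem quotientMap_injective (K : OpenSubgroup G) (M : OpenNormalSubgroup G) :
    Function.Injective (QuotientGroup.map (M.restrict K).toSubgroup M.toSubgroup
      K.toSubgroup.subtype fun _ hx => hx) := by
  refine (injective_iff_map_eq_one _).2 fun q hq => ?_
  obtain ⟨g, rfl⟩ := QuotientGroup.mk_surjective q
  exact (QuotientGroup.eq_one_iff g).2 ((QuotientGroup.eq_one_iff (g : G)).1 hq)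

/-- The restriction `k[G/M] → k[K/(M ∩ K)]` of coefficients. -/
noncomputable def restrictCoeff (K : OpenSubgroup G) (M : OpenNormalSubgroup G) :
    MonoidAlgebra k (G ⧸ M.toSubgroup) →+ MonoidAlgebra k (K ⧸ (M.restrict K).toSubgroup) :=
  MonoidAlgebra.comapDomainAddMonoidHom _ (quotientMap_injective K M)

theorem restrictCoeff_single_of_mem {K : OpenSubgroup G} (M : OpenNormalSubgroup G) {g : G}
    (hg : g ∈ K) (a : k) :
    restrictCoeff K M (MonoidAlgebra.single (g : G ⧸ M.toSubgroup) a) =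
      MonoidAlgebra.single (((⟨g, hg⟩ : K) : K ⧸ (M.restrict K).toSubgroup)) a :=
  MonoidAlgebra.comapDomain_single_map _ (quotientMap_injective K M)
    ((⟨g, hg⟩ : K) : K ⧸ (M.restrict K).toSubgroup) a

theorem restrictCoeff_single_of_notMem {K : OpenSubgroup G} {M : OpenNormalSubgroup G}
    (hM : M.toSubgroup ≤ K.toSubgroup) {g : G} (hg : g ∉ K) (a : k) :
    restrictCoeff K M (MonoidAlgebra.single (g : G ⧸ M.toSubgroup) a) = 0 := by
  refine MonoidAlgebra.comapDomain_single_of_not_mem_range ?_ (quotientMap_injective K M)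
  rintro ⟨q, hq⟩
  obtain ⟨x, rfl⟩ := QuotientGroup.mk_surjective q
  have : (x : G)⁻¹ * g ∈ M.toSubgroup := QuotientGroup.eq.1 hq
  exact hg (by simpa using mul_mem x.2 (hM this))

theorem restrict_mono {N M : OpenNormalSubgroup G} (h : N ≤ M) (K : OpenSubgroup G) :
    N.restrict K ≤ M.restrict K := fun _ hy => h hy

theorem restrictCoeff_transition (K : OpenSubgroup G) {N M : OpenNormalSubgroup G} (h : N ≤ M)
    (hM : M.toSubgroup ≤ K.toSubgroup) (x : MonoidAlgebra k (G ⧸ N.toSubgroup)) :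
    restrictCoeff K M (groupAlgebraTransition k G h x) =
      groupAlgebraTransition k K (restrict_mono h K) (restrictCoeff K N x) := by
  have hN : N.toSubgroup ≤ K.toSubgroup := fun _ hx => hM (h hx)
  induction x using induction_mk with
  | zero => simp only [map_zero]
  | add x y hx hy => simp only [map_add, hx, hy]
  | single g a =>
    by_cases hg : g ∈ K
    · rw [transition_single, restrictCoeff_single_of_mem M hg, restrictCoeff_single_of_mem N hg,
        transition_single]
    · rw [transition_single, restrictCoeff_single_of_notMem hM hg,
        restrictCoeff_single_of_notMem hN hg, map_zero]

theorem restrictCoeff_inclusion (K : OpenSubgroup G) (M : OpenNormalSubgroup G)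
    (y : MonoidAlgebra k (K ⧸ (M.restrict K).toSubgroup)) :
    restrictCoeff K M (groupAlgebraInclusion k K M y) = y := by
  induction y using induction_mk with
  | zero => simp only [map_zero]
  | add x y hx hy => simp only [map_add, hx, hy]
  | single g a => rw [inclusion_single, restrictCoeff_single_of_mem M g.2]

theorem transition_restrictCoeff_eq (K : OpenSubgroup G) {M' : OpenNormalSubgroup K}
    {M N : OpenNormalSubgroup G} (hM : M.toSubgroup ≤ K.toSubgroup) (hM' : M.restrict K ≤ M')
    (hN : N.toSubgroup ≤ K.toSubgroup) (hN' : N.restrict K ≤ M') (x : CompletedGroupAlgebra k G) :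
    groupAlgebraTransition k K hM' (restrictCoeff K M (x.1 M)) =
      groupAlgebraTransition k K hN' (restrictCoeff K N (x.1 N)) := by
  have key {M : OpenNormalSubgroup G} (hM : M.toSubgroup ≤ K.toSubgroup)
      (hM' : M.restrict K ≤ M') (L : OpenNormalSubgroup G) (hLM : L ≤ M) :
      groupAlgebraTransition k K hM' (restrictCoeff K M (x.1 M)) =
        groupAlgebraTransition k K ((restrict_mono hLM K).trans hM')
          (restrictCoeff K L (x.1 L)) := by
    rw [← x.2 L M hLM, restrictCoeff_transition K hLM hM, transition_trans]
  rw [key hM hM' (M ⊓ N) inf_le_left, key hN hN' (M ⊓ N) inf_le_right]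

/-- The projection of `k[G/M]` onto the span of the image of `K`. -/
noncomputable def levelProj (K : OpenSubgroup G) (M : OpenNormalSubgroup G) :
    MonoidAlgebra k (G ⧸ M.toSubgroup) →+ MonoidAlgebra k (G ⧸ M.toSubgroup) :=
  (groupAlgebraInclusion k K M).toRingHom.toAddMonoidHom.comp (restrictCoeff K M)

theorem levelProj_apply (K : OpenSubgroup G) (M : OpenNormalSubgroup G)
    (z : MonoidAlgebra k (G ⧸ M.toSubgroup)) :
    levelProj K M z = groupAlgebraInclusion k K M (restrictCoeff K M z) := rfl

theorem levelProj_single_of_mem {K : OpenSubgroup G} (M : OpenNormalSubgroup G) {g : G}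
    (hg : g ∈ K) (a : k) :
    levelProj K M (MonoidAlgebra.single (g : G ⧸ M.toSubgroup) a) =
      MonoidAlgebra.single (g : G ⧸ M.toSubgroup) a := by
  rw [levelProj_apply, restrictCoeff_single_of_mem M hg, inclusion_single]

theorem levelProj_single_of_notMem {K : OpenSubgroup G} {M : OpenNormalSubgroup G}
    (hM : M.toSubgroup ≤ K.toSubgroup) {g : G} (hg : g ∉ K) (a : k) :
    levelProj K M (MonoidAlgebra.single (g : G ⧸ M.toSubgroup) a) = 0 := by
  rw [levelProj_apply, restrictCoeff_single_of_notMem hM hg, map_zero]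

/-- The image of `kK` in `kG`, as an additive subgroup. -/
noncomputable def subalgebraImage (k : Type*) [Field k] (K : OpenSubgroup G) :
    Submodule ℤ (CompletedGroupAlgebra k G) :=
  imageSubmodule (completedInclusion k K).toRingHom ⊤

theorem levelProj_levelProj {L K : OpenSubgroup G} (hLK : L ≤ K) {M : OpenNormalSubgroup G}
    (hM : M.toSubgroup ≤ L.toSubgroup) (z : MonoidAlgebra k (G ⧸ M.toSubgroup)) :
    levelProj K M (levelProj L M z) = levelProj L M z := by
  induction z using induction_mk with
  | zero => simp only [map_zero]
  | add x y hx hy => simp only [map_add, hx, hy]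
  | single g a =>
    by_cases hg : g ∈ L
    · rw [levelProj_single_of_mem M hg, levelProj_single_of_mem M (hLK hg)]
    · rw [levelProj_single_of_notMem hM hg, map_zero]

/-- The group elements, as elements of `kG`. -/
noncomputable def groupElement (k : Type*) [Field k] (G : Type*) [Group G] [TopologicalSpace G] :
    G →* CompletedGroupAlgebra k G where
  toFun g := ⟨fun _ => MonoidAlgebra.single (QuotientGroup.mk g) 1,
    fun _ _ h => transition_single h g 1⟩
  map_one' := rfl
  map_mul' g g' := Subtype.ext (funext fun N => by
    change MonoidAlgebra.single ((g * g' : G) : G ⧸ N.toSubgroup) (1 : k) =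
      MonoidAlgebra.single (g : G ⧸ N.toSubgroup) 1 * MonoidAlgebra.single (g' : G ⧸ N.toSubgroup) 1
    rw [MonoidAlgebra.single_mul_single, mul_one]; rfl)

/-- The group elements, as units of `kG`. -/
noncomputable def groupUnit (k : Type*) [Field k] (G : Type*) [Group G] [TopologicalSpace G] :
    G →* (CompletedGroupAlgebra k G)ˣ := (groupElement k G).toHomUnits

theorem mul_groupUnit_apply (x : CompletedGroupAlgebra k G) (g : G) (M : OpenNormalSubgroup G) :
    (x * (groupUnit k G g : CompletedGroupAlgebra k G)).1 M =
      x.1 M * MonoidAlgebra.single (g : G ⧸ M.toSubgroup) 1 := rfl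

theorem groupUnit_mul_apply (x : CompletedGroupAlgebra k G) (g : G) (M : OpenNormalSubgroup G) :
    ((groupUnit k G g : CompletedGroupAlgebra k G) * x).1 M =
      MonoidAlgebra.single (g : G ⧸ M.toSubgroup) 1 * x.1 M := rfl

theorem single_mul_single_mk (M : OpenNormalSubgroup G) (g g' : G) (a b : k) :
    MonoidAlgebra.single (g : G ⧸ M.toSubgroup) a * MonoidAlgebra.single (g' : G ⧸ M.toSubgroup) b =
      MonoidAlgebra.single ((g * g' : G) : G ⧸ M.toSubgroup) (a * b) :=
  MonoidAlgebra.single_mul_single ..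

variable [IsTopologicalGroup G] [CompactSpace G]


/-- The largest normal subgroup contained in an open subgroup, as an open normal subgroup. -/
def openNormalCore (K : OpenSubgroup G) : OpenNormalSubgroup G where
  toSubgroup := K.toSubgroup.normalCore
  isOpen' := by
    have : K.toSubgroup.FiniteIndex :=
      have := K.toSubgroup.quotient_finite_of_isOpen K.isOpen
      Subgroup.finiteIndex_of_finite_quotient
    exact Subgroup.isOpen_of_isClosed_of_finiteIndex _ (K.toSubgroup.normalCore_isClosed K.isClosed)
  isNormal' := K.toSubgroup.normalCore_normal

theorem openNormalCore_le (K : OpenSubgroup G) : (openNormalCore K).toSubgroup ≤ K.toSubgroup :=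
  K.toSubgroup.normalCore_le

theorem exists_restrict_le (K : OpenSubgroup G) (M' : OpenNormalSubgroup K) :
    ∃ M : OpenNormalSubgroup G, M.toSubgroup ≤ K.toSubgroup ∧ M.restrict K ≤ M' := by
  let L : OpenSubgroup G :=
    { toSubgroup := M'.toSubgroup.map K.toSubgroup.subtype
      isOpen' := K.isOpen.isOpenMap_subtype_val _ M'.isOpen' }
  refine ⟨openNormalCore L, fun x hx => ?_, fun x hx => ?_⟩
  · obtain ⟨y, -, rfl⟩ := openNormalCore_le L hx
    exact y.2
  · obtain ⟨y, hy, hyx⟩ := openNormalCore_le L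
      (show (x : G) ∈ (openNormalCore L).toSubgroup from hx)
    rwa [← Subtype.ext (show (y : G) = x from hyx)]

/-- An open normal subgroup of `G` contained in `K`, whose intersection with `K` is contained in the
given open normal subgroup of `K`. -/
noncomputable def restrictLevel (K : OpenSubgroup G) (M' : OpenNormalSubgroup K) :
    OpenNormalSubgroup G := (exists_restrict_le K M').choose

theorem restrictLevel_le (K : OpenSubgroup G) (M' : OpenNormalSubgroup K) :
    (restrictLevel K M').toSubgroup ≤ K.toSubgroup := (exists_restrict_le K M').choose_spec.1

theorem restrict_restrictLevel_le (K : OpenSubgroup G) (M' : OpenNormalSubgroup K) :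
    (restrictLevel K M').restrict K ≤ M' := (exists_restrict_le K M').choose_spec.2

/-- The restriction `kG → k[K/M']` of the coefficients to the open subgroup `K`. -/
noncomputable def restrictionComponent (K : OpenSubgroup G) (M' : OpenNormalSubgroup K)
    (x : CompletedGroupAlgebra k G) : MonoidAlgebra k (K ⧸ M'.toSubgroup) :=
  groupAlgebraTransition k K (restrict_restrictLevel_le K M')
    (restrictCoeff K (restrictLevel K M') (x.1 (restrictLevel K M')))

theorem restrictionComponent_eq {K : OpenSubgroup G} {M' : OpenNormalSubgroup K}
    {M : OpenNormalSubgroup G} (hM : M.toSubgroup ≤ K.toSubgroup) (hM' : M.restrict K ≤ M')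
    (x : CompletedGroupAlgebra k G) :
    restrictionComponent K M' x = groupAlgebraTransition k K hM' (restrictCoeff K M (x.1 M)) :=
  transition_restrictCoeff_eq K (restrictLevel_le K M') (restrict_restrictLevel_le K M') hM hM' x

/-- The restriction `kG → kK` of the coefficients to the open subgroup `K`: a left inverse of the
inclusion. -/
noncomputable def completedRestriction (K : OpenSubgroup G) (x : CompletedGroupAlgebra k G) :
    CompletedGroupAlgebra k K :=
  ⟨fun M' => restrictionComponent K M' x, fun N' M' h => by
    change groupAlgebraTransition k K h (restrictionComponent K N' x) =
      restrictionComponent K M' x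
    rw [restrictionComponent_eq (restrictLevel_le K N')
      ((restrict_restrictLevel_le K N').trans h) x, restrictionComponent, transition_trans]⟩

/-- The projection of `kG` onto the image of `kK`. -/
noncomputable def completedProj (K : OpenSubgroup G) (x : CompletedGroupAlgebra k G) :
    CompletedGroupAlgebra k G := completedInclusion k K (completedRestriction K x)

theorem completedProj_apply {K : OpenSubgroup G} {M : OpenNormalSubgroup G}
    (hM : M.toSubgroup ≤ K.toSubgroup) (x : CompletedGroupAlgebra k G) :
    (completedProj K x).1 M = levelProj K M (x.1 M) := by
  change groupAlgebraInclusion k K M (restrictionComponent K (M.restrict K) x) = _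
  rw [restrictionComponent_eq hM le_rfl, transition_refl, levelProj_apply]

theorem ext_of_le (K : OpenSubgroup G) {x y : CompletedGroupAlgebra k G}
    (h : ∀ M : OpenNormalSubgroup G, M.toSubgroup ≤ K.toSubgroup → x.1 M = y.1 M) : x = y := by
  refine Subtype.ext (funext fun M => ?_)
  have hle : M ⊓ openNormalCore K ≤ M := inf_le_left
  have hle' : M ⊓ openNormalCore K ≤ openNormalCore K := inf_le_right
  rw [← x.2 _ M hle, ← y.2 _ M hle, h _ fun g hg => openNormalCore_le K (hle' hg)]

theorem completedRestriction_inclusion (K : OpenSubgroup G) (y : CompletedGroupAlgebra k K) :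
    completedRestriction K (completedInclusion k K y) = y := by
  refine Subtype.ext (funext fun M' => ?_)
  change groupAlgebraTransition k K (restrict_restrictLevel_le K M') (restrictCoeff K _
    (groupAlgebraInclusion k K _ (y.1 ((restrictLevel K M').restrict K)))) = y.1 M'
  rw [← y.2 _ M' (restrict_restrictLevel_le K M'), restrictCoeff_inclusion]

theorem completedInclusion_injective (K : OpenSubgroup G) :
    Function.Injective (completedInclusion k K) :=
  Function.LeftInverse.injective (completedRestriction_inclusion K)

theorem completedProj_mem (K : OpenSubgroup G) (x : CompletedGroupAlgebra k G) :
    completedProj K x ∈ subalgebraImage k K := ⟨completedRestriction K x, trivial, rfl⟩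

theorem mem_subalgebraImage {K : OpenSubgroup G} {x : CompletedGroupAlgebra k G} :
    x ∈ subalgebraImage k K ↔ completedProj K x = x := by
  constructor
  · rintro ⟨y, -, rfl⟩
    exact congrArg (completedInclusion k K) (completedRestriction_inclusion K y)
  · intro h; rw [← h]; exact completedProj_mem K x

theorem subalgebraImage_mono {L K : OpenSubgroup G} (hLK : L ≤ K) :
    subalgebraImage k L ≤ subalgebraImage k K := by
  intro x hx
  rw [mem_subalgebraImage] at hx ⊢
  refine ext_of_le L fun M hM => ?_
  rw [completedProj_apply (hM.trans hLK), ← hx, completedProj_apply hM, levelProj_levelProj hLK hM]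

theorem subalgebraImage_top : subalgebraImage k (⊤ : OpenSubgroup G) = ⊤ := by
  refine top_le_iff.1 fun x _ => mem_subalgebraImage.2 (ext_of_le ⊤ fun M hM => ?_)
  rw [completedProj_apply hM]
  induction x.1 M using induction_mk with
  | zero => simp only [map_zero]
  | add x y hx hy => simp only [map_add, hx, hy]
  | single g a => exact levelProj_single_of_mem M (OpenSubgroup.mem_top g) a

end Concrete

/-! ### Completed group algebras as crossed products -/

section CompletedCrossed

variable {k : Type*} [Field k] {G : Type*} [Group G] [TopologicalSpace G]

/-- The component of `kG` at an open normal subgroup. -/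
noncomputable def evalHom (k : Type*) [Field k] (M : OpenNormalSubgroup G) :
    CompletedGroupAlgebra k G →+* MonoidAlgebra k (G ⧸ M.toSubgroup) :=
  ((Pi.evalAlgHom k _ M).comp (completedGroupSubalgebra k G).val).toRingHom

theorem evalHom_apply (M : OpenNormalSubgroup G) (x : CompletedGroupAlgebra k G) :
    evalHom k M x = x.1 M := rfl

theorem levelProj_mul_single_of_notMem {L : OpenSubgroup G} {M : OpenNormalSubgroup G}
    (hM : M.toSubgroup ≤ L.toSubgroup) {g : G} (hg : g ∉ L)
    (z : MonoidAlgebra k (G ⧸ M.toSubgroup)) :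
    levelProj L M (levelProj L M z * MonoidAlgebra.single (g : G ⧸ M.toSubgroup) 1) = 0 := by
  induction z using induction_mk with
  | zero => simp only [map_zero, zero_mul]
  | add x y hx hy => rw [map_add, add_mul, map_add, hx, hy, add_zero]
  | single x a =>
    by_cases hx : x ∈ L
    · rw [levelProj_single_of_mem M hx, single_mul_single_mk, levelProj_single_of_notMem hM]
      rwa [mul_mem_cancel_left hx]
    · rw [levelProj_single_of_notMem hM hx, zero_mul, map_zero]

theorem levelProj_conj {L : OpenSubgroup G} (hL : L.toSubgroup.Normal) {M : OpenNormalSubgroup G}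
    (hM : M.toSubgroup ≤ L.toSubgroup) (g : G) (z : MonoidAlgebra k (G ⧸ M.toSubgroup)) :
    levelProj L M (MonoidAlgebra.single (g : G ⧸ M.toSubgroup) 1 * levelProj L M z *
        MonoidAlgebra.single ((g⁻¹ : G) : G ⧸ M.toSubgroup) 1) =
      MonoidAlgebra.single (g : G ⧸ M.toSubgroup) 1 * levelProj L M z *
        MonoidAlgebra.single ((g⁻¹ : G) : G ⧸ M.toSubgroup) 1 := by
  induction z using induction_mk with
  | zero => simp only [map_zero, zero_mul, mul_zero]
  | add x y hx hy => rw [map_add, mul_add, add_mul, map_add, hx, hy]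
  | single x a =>
    by_cases hx : x ∈ L
    · rw [levelProj_single_of_mem M hx, single_mul_single_mk, single_mul_single_mk,
        levelProj_single_of_mem]
      exact hL.conj_mem x hx g
    · rw [levelProj_single_of_notMem hM hx, mul_zero, zero_mul, map_zero]

/-- A right transversal `t` of `L` in `K` decomposes the span of the image of `K` in `k[G/M]`. -/
theorem sum_levelProj {L K : OpenSubgroup G} (hLK : L ≤ K) {M : OpenNormalSubgroup G}
    (hM : M.toSubgroup ≤ L.toSubgroup) {m : ℕ} {t : Fin m → G} (htK : ∀ j, t j ∈ K)
    (ht : ∀ g ∈ K, ∃! j, g * (t j)⁻¹ ∈ L) (z : MonoidAlgebra k (G ⧸ M.toSubgroup)) :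
    ∑ j, levelProj L M (z * MonoidAlgebra.single (((t j)⁻¹ : G) : G ⧸ M.toSubgroup) 1) *
      MonoidAlgebra.single ((t j : G) : G ⧸ M.toSubgroup) 1 = levelProj K M z := by
  induction z using induction_mk with
  | zero => simp only [map_zero, zero_mul, Finset.sum_const_zero]
  | add x y hx hy => simp only [add_mul, map_add, Finset.sum_add_distrib, hx, hy]
  | single x a =>
    simp only [single_mul_single_mk]
    by_cases hx : x ∈ K
    · obtain ⟨j, hj, huniq⟩ := ht x hx
      rw [Finset.sum_eq_single j]
      · rw [levelProj_single_of_mem M hj, levelProj_single_of_mem M hx, single_mul_single_mk]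
        simp
      · intro i _ hij
        rw [levelProj_single_of_notMem hM fun hi => hij (huniq i hi), zero_mul]
      · simp
    · rw [levelProj_single_of_notMem (hM.trans hLK) hx]
      refine Finset.sum_eq_zero fun i _ => ?_
      rw [levelProj_single_of_notMem hM, zero_mul]
      intro hi
      exact hx (by simpa using mul_mem (hLK hi) (htK i))

theorem subalgebraImage_isSubring (K : OpenSubgroup G) : IsSubringIn (subalgebraImage k K) where
  one_le := Submodule.one_le.2 ⟨1, trivial, map_one _⟩
  mul_le := (imageSubmodule_isIdeal ⊤).mul_left

variable [IsTopologicalGroup G] [CompactSpace G]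

theorem completedProj_add (K : OpenSubgroup G) (x y : CompletedGroupAlgebra k G) :
    completedProj K (x + y) = completedProj K x + completedProj K y := by
  refine ext_of_le K fun M hM => ?_
  change _ = (completedProj K x).1 M + (completedProj K y).1 M
  rw [completedProj_apply hM, completedProj_apply hM, completedProj_apply hM, ← map_add]
  rfl

/-- `completedProj` as an additive map. -/
noncomputable def completedProjHom (k : Type*) [Field k] (K : OpenSubgroup G) :
    CompletedGroupAlgebra k G →+ CompletedGroupAlgebra k G :=
  AddMonoidHom.mk' (completedProj K) (completedProj_add K)

theorem groupUnit_mem {K : OpenSubgroup G} {g : G} (hg : g ∈ K) :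
    (groupUnit k G g : CompletedGroupAlgebra k G) ∈ subalgebraImage k K := by
  refine mem_subalgebraImage.2 (ext_of_le K fun M hM => ?_)
  rw [completedProj_apply hM]
  exact levelProj_single_of_mem M hg 1

theorem completedProj_mul_groupUnit {L : OpenSubgroup G} {g : G} (hg : g ∉ L)
    {x : CompletedGroupAlgebra k G} (hx : x ∈ subalgebraImage k L) :
    completedProj L (x * (groupUnit k G g : CompletedGroupAlgebra k G)) = 0 := by
  refine ext_of_le L fun M hM => ?_
  rw [completedProj_apply hM, mul_groupUnit_apply, ← mem_subalgebraImage.1 hx,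
    completedProj_apply hM, levelProj_mul_single_of_notMem hM hg]
  rfl

theorem conj_subalgebraImage_le {L : OpenSubgroup G} (hL : L.toSubgroup.Normal) (g : G) :
    conj (groupUnit k G) g (subalgebraImage k L) ≤ subalgebraImage k L := by
  intro x hx
  rw [mem_conj] at hx
  have hx' := mem_subalgebraImage.1 hx
  refine mem_subalgebraImage.2 (ext_of_le L fun M hM => ?_)
  have e : x = (groupUnit k G g : CompletedGroupAlgebra k G) *
      (↑(groupUnit k G g)⁻¹ * x * ↑(groupUnit k G g)) * ↑(groupUnit k G g⁻¹) := by
    rw [map_inv]; simp [mul_assoc]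
  rw [completedProj_apply hM, e, mul_groupUnit_apply, groupUnit_mul_apply, ← hx',
    completedProj_apply hM, levelProj_conj hL hM]

section Transversal

variable {L K : OpenSubgroup G} (hLK : L ≤ K) {m : ℕ} {t : Fin m → G} (htK : ∀ j, t j ∈ K)
  (ht : ∀ g ∈ K, ∃! j, g * (t j)⁻¹ ∈ L)

include hLK htK ht

theorem sum_completedProj {x : CompletedGroupAlgebra k G} (hx : x ∈ subalgebraImage k K) :
    ∑ j, completedProj L (x * (groupUnit k G (t j)⁻¹ : CompletedGroupAlgebra k G)) *
      (groupUnit k G (t j) : CompletedGroupAlgebra k G) = x := by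
  refine ext_of_le L fun M hM => ?_
  rw [← evalHom_apply, map_sum]
  simp only [evalHom_apply, mul_groupUnit_apply, completedProj_apply hM]
  rw [sum_levelProj hLK hM htK ht, ← completedProj_apply (hM.trans hLK),
    mem_subalgebraImage.1 hx]

theorem subalgebraImage_eq_iSup :
    subalgebraImage k K = ⨆ j, subalgebraImage k L * unitSpan (groupUnit k G) (t j) := by
  apply le_antisymm
  · intro x hx
    exact mem_iSup_mul_unitSpan.2 ⟨_, fun j => completedProj_mem L _,
      sum_completedProj hLK htK ht hx⟩
  · refine iSup_le fun j => le_trans (mul_le_mul' (subalgebraImage_mono hLK) ?_)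
      (subalgebraImage_isSubring K).mul_le
    exact (Submodule.span_singleton_le_iff_mem _ _).2 (groupUnit_mem (htK j))

omit hLK in
theorem subalgebraImage_free (r : Fin m → CompletedGroupAlgebra k G)
    (hr : ∀ i, r i ∈ subalgebraImage k L)
    (h0 : ∑ i, r i * (groupUnit k G (t i) : CompletedGroupAlgebra k G) = 0) (i : Fin m) :
    r i = 0 := by
  have h1 : completedProjHom k L ((∑ j, r j * (groupUnit k G (t j) : CompletedGroupAlgebra k G)) *
      (groupUnit k G (t i)⁻¹ : CompletedGroupAlgebra k G)) = 0 := by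
    rw [h0, zero_mul, map_zero]
  simp only [Finset.sum_mul, mul_assoc, ← Units.val_mul, ← map_mul, map_sum] at h1
  rw [Finset.sum_eq_single i] at h1
  · rw [mul_inv_cancel, map_one, Units.val_one, mul_one] at h1
    rw [← mem_subalgebraImage.1 (hr i)]; exact h1
  · intro j _ hji
    refine completedProj_mul_groupUnit (fun hmem => hji ?_) (hr j)
    refine (ht (t j) (htK j)).unique ?_ hmem
    rw [mul_inv_cancel]; exact one_mem L
  · simp

end Transversal

/-- A right transversal of an open subgroup in another one, lifted along a homomorphism onto the
larger subgroup. -/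
theorem exists_transversal {L K : OpenSubgroup G} {Γ : Type*} [Group Γ] (φ : Γ →* G)
    (hφ : φ.range = K.toSubgroup) :
    ∃ (m : ℕ) (s : Fin m → Γ), ∀ g ∈ K, ∃! j, g * (φ (s j))⁻¹ ∈ L := by
  have hfin : Finite (G ⧸ L.toSubgroup) := L.toSubgroup.quotient_finite_of_isOpen L.isOpen
  have hL : L.toSubgroup.FiniteIndex := Subgroup.finiteIndex_of_finite_quotient
  have e := Finite.equivFin (K.toSubgroup ⧸ L.toSubgroup.subgroupOf K.toSubgroup)
  have hlift (q : K.toSubgroup ⧸ L.toSubgroup.subgroupOf K.toSubgroup) :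
      ∃ x : Γ, φ x = ((q.out : K.toSubgroup) : G)⁻¹ := by
    have : ((q.out : K.toSubgroup) : G)⁻¹ ∈ φ.range := by rw [hφ]; exact inv_mem q.out.2
    exact this
  choose f hf using hlift
  have key (g : G) (hg : g ∈ K) (q : K.toSubgroup ⧸ L.toSubgroup.subgroupOf K.toSubgroup) :
      g * (φ (f q))⁻¹ ∈ L ↔
        q = QuotientGroup.mk (s := L.toSubgroup.subgroupOf K.toSubgroup)
          (⟨g, hg⟩ : K.toSubgroup)⁻¹ := by
    rw [hf, inv_inv, eq_comm]
    conv_rhs => rw [← QuotientGroup.out_eq' q, QuotientGroup.eq]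
    rw [inv_inv]; rfl
  refine ⟨_, fun j => f (e.symm j), fun g hg => ⟨e _, (key g hg _).2 (e.symm_apply_apply _),
    fun j hj => ?_⟩⟩
  rw [← (key g hg _).1 hj, Equiv.apply_symm_apply]

/-- If `L ≤ K` are open subgroups of `G` and `L` is normal in `G`, then `kK` is a crossed product
over `kL`. -/
theorem isCrossed_subalgebraImage {L K : OpenSubgroup G} (hLK : L ≤ K) (hL : L.toSubgroup.Normal)
    {Γ : Type*} [Group Γ] (φ : Γ →* G) (hφ : φ.range = K.toSubgroup) {m : ℕ} {s : Fin m → Γ}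
    (hs : ∀ g ∈ K, ∃! j, g * (φ (s j))⁻¹ ∈ L) :
    IsCrossed ((groupUnit k G).comp φ) (subalgebraImage k L) (subalgebraImage k K) s := by
  have hφK (x : Γ) : φ x ∈ K := by
    have : φ x ∈ φ.range := ⟨x, rfl⟩
    rw [hφ] at this; exact this
  have hle {x : Γ} (hx : φ x ∈ L) :
      unitSpan ((groupUnit k G).comp φ) x ≤ subalgebraImage k L :=
    (Submodule.span_singleton_le_iff_mem _ _).2 (groupUnit_mem hx)
  refine ⟨subalgebraImage_isSubring L, fun g => ?_, fun g => ?_,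
    subalgebraImage_eq_iSup hLK (fun j => hφK (s j)) hs,
    subalgebraImage_free (fun j => hφK (s j)) hs⟩
  · rw [conj_comp]; exact conj_subalgebraImage_le hL (φ g)
  · obtain ⟨j, hj, -⟩ := hs (φ g) (hφK g)
    refine ⟨j, hle ?_, hle ?_⟩
    · rwa [map_mul, map_inv]
    · have := inv_mem hj
      rwa [mul_inv_rev, inv_inv, ← map_inv, ← map_mul] at this

theorem imageSubmodule_id_top {T : Type*} [Ring T] :
    imageSubmodule (RingHom.id T) ⊤ = ⊤ := top_le_iff.1 fun x _ => ⟨x, trivial, rfl⟩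

end CompletedCrossed

end CrossedExt

theorem mainTheorem7 (p : ℕ) [Fact p.Prime]
    (k : Type*) [Field k] [CharP k p]
    (G : Type*) [Group G] [TopologicalSpace G] [IsTopologicalGroup G] [CompactSpace G]
    (hG : IsPAdicAnalyticGroup p G)
    (H : OpenSubgroup G)
    (Q : TwoSidedIdeal (CompletedGroupAlgebra k H)) (hQ : IsPrimeTwoSided Q)
    (P : TwoSidedIdeal (CompletedGroupAlgebra k G)) (hP : IsPrimeTwoSided P)
    (hPQ : inducedIdeal Q ≤ P)
    (hmin : ∀ P' : TwoSidedIdeal (CompletedGroupAlgebra k G),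
      IsPrimeTwoSided P' → inducedIdeal Q ≤ P' → P' ≤ P → P' = P) :
    primeHeight ⟨P, hP⟩ = primeHeight ⟨Q, hQ⟩ := by
  open CrossedExt in
  let N : OpenSubgroup G := (openNormalCore H).toOpenSubgroup
  have hNH : N ≤ H := openNormalCore_le H
  have hN : N.toSubgroup.Normal := (openNormalCore H).isNormal'
  obtain ⟨m, s, hs⟩ := exists_transversal (L := N) (K := ⊤) (MonoidHom.id G)
    (MonoidHom.range_eq_top.2 Function.surjective_id)
  obtain ⟨m', s', hs'⟩ := exists_transversal (L := N) (K := H) H.toSubgroup.subtype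
    H.toSubgroup.range_subtype
  obtain ⟨l, t, ht⟩ := exists_transversal (L := H) (K := ⊤) (MonoidHom.id G)
    (MonoidHom.range_eq_top.2 Function.surjective_id)
  have hT := isCrossed_subalgebraImage (k := k) (le_top : N ≤ ⊤) hN (MonoidHom.id G)
    (MonoidHom.range_eq_top.2 Function.surjective_id) hs
  have hS := isCrossed_subalgebraImage (k := k) hNH hN H.toSubgroup.subtype
    H.toSubgroup.range_subtype hs'
  have hspan := subalgebraImage_eq_iSup (k := k) (le_top : H ≤ ⊤)
    (fun j => OpenSubgroup.mem_top (t j)) ht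
  have hfree := subalgebraImage_free (k := k) (L := H) (fun j => OpenSubgroup.mem_top (t j)) ht
  rw [MonoidHom.comp_id, subalgebraImage_top] at hT
  rw [subalgebraImage_top] at hspan
  have hid : Function.Injective (RingHom.id (CompletedGroupAlgebra k G)) := fun _ _ h => h
  have hinc : Function.Injective (completedInclusion k H).toRingHom :=
    completedInclusion_injective H
  have hQ' := (isPrimeIn_imageSubmodule hinc).2 hQ
  have hP' := (isPrimeIn_imageSubmodule hid).2 hP
  rw [primeHeight_eq hid hP hP', primeHeight_eq hinc hQ hQ']
  have key (S : Submodule ℤ (CompletedGroupAlgebra k G)) (hS' : S = ⊤)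
      (hP' : IsPrimeIn S (imageSubmodule (RingHom.id _) P)) :
      Order.height (⟨_, hP'⟩ : {X // IsPrimeIn S X}) = Order.height
        (⟨_, hQ'⟩ : {X // IsPrimeIn (subalgebraImage k H) X}) := by
    subst hS'
    refine height_eq_of_minimal_induced hT hS hspan hfree hQ' hP' ?_ ?_
    · rw [← imageSubmodule_id_inducedIdeal, imageSubmodule_le hid]; exact hPQ
    · intro X hX hKX hXP
      have hX' := hX.isIdeal
      rw [← imageSubmodule_id_top] at hX'
      obtain ⟨I, rfl⟩ := exists_imageSubmodule_eq hX'
      rw [← imageSubmodule_id_inducedIdeal, imageSubmodule_le hid] at hKX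
      rw [imageSubmodule_le hid] at hXP
      rw [← imageSubmodule_id_top, isPrimeIn_imageSubmodule hid] at hX
      rw [hmin I hX hKX hXP]
  exact key _ imageSubmodule_id_top hP'
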